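/- **Model.** The network is a connected graph $G$ on the processors $\{0,\dots,n-1\}$, $n\ge 2$, with maximal degree $\Delta$ and diameter $D$; $N_p$ is the set of neighbours of $p$. In a step, a non-empty set of processors having enabled actions (if there are any) is chosen, and each chosen processor executes one of its enabled actions (guarded rules reading its own and its neighbours' variables). The daemon is weakly fair: every continuously enabled action is eventually executed. A round is a minimal segment of the execution in which every action enabled at its beginning is executed or neutralized (becomes disabled without having been executed). $\mathcal A$ is any silent self-stabilizing algorithm computing routing tables $\mathrm{nextHop}_p(d)\in N_p$ (for $d=p$ an arbitrary neighbour): there is a number of rounds within which every execution of $\mathcal A$ reaches a configuration with no enabled action of $\mathcal A$ and with tables inducing shortest paths. $R_{\mathcal A}$ is the least such number. **Protocol $\mathcal{SSMFP}_2$.** Each processor $p$ has buffers $buf_p(1),\dots,buf_p(D+1)$, each empty ($\varepsilon$) or containing a message $(m,r,q,d,c)$ (information, next processor $r\in N_p$, last processor $q\in N_p$, destination, type $c\in\{S,A,F\}$), a Boolean $request_p$, and possibly a message with a destination waiting in its higher layer. The waiting message stays until it is sent; the higher layer may set $request_p$ from false to true when a message is waiting, and never withdraws a request. For $2\le i\le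 D+1$, $choice_p(i)$ is the head of a first-in first-out queue of the processors $s\in N_p$ with $buf_s(i-1)=(m,p,q,d,S)$ for some $m,q$ and $d\ne s$. In the rules of $p$ below, $\overline c$ denotes a type in $\{F,A\}$; a condition "$buf\neq$ pattern" means that no values of the letters that occur only in this pattern give equality. * $R_1$: if $request_p$, $buf_p(1)=\varepsilon$, $m$ with destination $d$ is waiting, and $buf_{\mathrm{nextHop}_p(d)}(2)\ne(m,r',p,d,c)$: $buf_p(1):=(m,\mathrm{nextHop}_p(d),r,d,S)$ for some $r\in N_p$, and $request_p:=$ false. * $R_2$: $buf_p(1)=(m,r,q,d,F)$, $d\ne p$, $buf_r(2)\ne(m,r',p,d,F)$: $buf_p(1):=(m,\mathrm{nextHop}_p(d),q,d,S)$. * $R_3$: $buf_p(1)=(m,r,q,d,A)$, $d\neq p$, $buf_r(2)\ne(m,r',p,d,A)$: $buf_p(1):=\varepsilon$. * $R_4,R_5,R_6$: if $buf_p(1)=(m,r,q,p,c)$: for $c=S$ deliver $m$ and set the type to $A$; for $c=A$ empty the buffer; for $c=F$ set the type to $S$. * $R_7$ ($1\le i\le D$): $buf_p(i)=(m,r,q,d,S)$,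 $p\ne d$, $buf_r(i+1)=(m,r',p,d,\overline c)$: $buf_p(i):=(m,r,q,d,\overline c)$. * $R_8$ ($2\le i\le D$): $buf_p(i)=\varepsilon$, $choice_p(i)=s$, $buf_s(i-1)=(m,p,q,d,S)$, $buf_{\mathrm{nextHop}_p(d)}(i+1)\ne(m,r,p,d,c)$: $buf_p(i):=(m,\mathrm{nextHop}_p(d),s,d,S)$. * $R_9$ ($2\le i\le D$): $buf_p(i)=(m,r,q,d,\overline c)$, $d\ne p$, $buf_q(i-1)=(m,p,q',d,\overline c)$, $buf_r(i+1)\ne(m,r',p,d,\overline c)$: $buf_p(i):=\varepsilon$. * $R_{10}$ ($2\le i\le D+1$): $buf_p(i)=(m,r,q,p,S)$: deliver $m$ and set the type to $A$. * $R_{11}$ ($2\le i\le D+1$): $buf_p(i)=(m,r,q,p,\overline c)$, $buf_q(i-1)=(m,p,q',p,\overline c)$: $buf_p(i):=\varepsilon$. * $R_{12}$: $buf_p(D+1)=\varepsilon$, $choice_p(D+1)=s$, $buf_s(D)=(m,p,q,d,S)$: $buf_p(D+1):=(m,\mathrm{nextHop}_p(d),s,d,S)$. * $R_{13}$: $buf_p(D+1)=(m,r,q,d,S)$,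 $d\ne p$: set the type to $F$. * $R_{14}$: $buf_p(D+1)=(m,r,q,d,\overline c)$, $d\ne p$, $buf_q(D)=(m,p,q',d,\overline c)$: $buf_p(D+1):=\varepsilon$. * $R_{15}$ ($2\le i\le D$): $buf_p(i)=(m,r,q,d,\overline c)$, $buf_r(i+1)\ne(m,r',p,d,\overline c)$, $buf_q(i-1)\ne(m,p,q',d,c')$: $buf_p(i):=\varepsilon$. * $R_{16}$ ($2\le i\le D$): $buf_p(i)=(m,r,q,d,\overline c)$, $buf_r(i+1)\ne(m,r',p,d,\overline c)$, $buf_q(i-1)=(m,p,q',d,c')$ with $c'\in\{F,A\}\setminus\{\overline c\}$ or $q=d$: $buf_p(i):=\varepsilon$. * $R_{17},R_{18}$: as $R_{15},R_{16}$ for $i=D+1$, without the condition on $buf_r(i+1)$. $\mathcal{SSMFP}_2$ runs simultaneously with $\mathcal A$, which has priority: a processor with an enabled action of $\mathcal A$ executes no rule of $\mathcal{SSMFP}_2$. Rules applied to buffers of different ranks count as different actions. The initial configuration (tables, buffers, requests, order of the queues) is arbitrary. An emission of $p$ is an execution of $R_1$ by $p$. **Proposition.** There is an absolute constant $C$ such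 that for all $G$, $\mathcal A$ as above and every execution and every processor $p$, with $B=C\max(R_{\mathcal A},\,nD\Delta^D)$: (i) (delay) if $p$ has a waiting message and $request_p$ is true in a configuration before which $p$ has emitted nothing, then $p$ makes its first emission within $B$ rounds from that configuration; (ii) (waiting time) if after an emission of $p$ the next message is waiting and $request_p$ is true in a configuration preceding the next emission (for example immediately after the former emission), then the next emission of $p$ occurs within $B$ rounds from that configuration. -/

import Mathlib

namespace SSMFP

/-! ## Scheduling: weak fairness and rounds

A run is observed through `en t p a` (action `a` of processor `p` is enabled in the `t`-th
configuration) and `ex t p` (the action executed by `p` in the step from the `t`-th to the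
`(t+1)`-st configuration, `none` if `p` is not chosen by the daemon in this step). -/

section Scheduling

variable {P α : Type}

/-- The daemon is weakly fair: an action that is enabled is eventually executed, unless it is
disabled at some later time. -/
def WeaklyFair (en : ℕ → P → α → Prop) (ex : ℕ → P → Option α) : Prop :=
  ∀ t p a, en t p a → ∃ u, t ≤ u ∧ (ex u p = some a ∨ ¬ en u p a)

/-- The segment from configuration `s` to configuration `t` is one round: it is the minimal
(nonempty) segment starting at `s` in which every action enabled in configuration `s` is executed
or is neutralized (it gets disabled without having been executed). -/
def IsRound (en : ℕ → P → α → Prop) (ex : ℕ → P → Option α) (s t : ℕ) : Prop :=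
  IsLeast {t | s < t ∧ ∀ p a, en s p a →
    ∃ u, s ≤ u ∧ u < t ∧ (ex u p = some a ∨ ¬ en (u + 1) p a)} t

/-- The configuration `t` is reached within the first `k` rounds of the suffix that starts with
configuration `s`; `b j` is the end of the `j`-th of these rounds. -/
def WithinRounds (en : ℕ → P → α → Prop) (ex : ℕ → P → Option α) (s t k : ℕ) : Prop :=
  ∃ b : ℕ → ℕ, b 0 = s ∧ (∀ j < k, IsRound en ex (b j) (b (j + 1))) ∧ t ≤ b k

end Scheduling

/-! ## Routing algorithms -/

/-- A distributed protocol in the locally shared memory model whose local states contain a routing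
table: `nextHop p x d` is the neighbour of `p` to which `p` forwards the messages of destination
`d` when the local state of `p` is `x` (an arbitrary neighbour of `p` if `d = p`). -/
structure RoutingAlgorithm {n : ℕ} (G : SimpleGraph (Fin n)) where
  State : Type
  Act : Type
  act_finite : Finite Act
  guard : (Fin n → State) → Fin n → Act → Prop
  stmt : (Fin n → State) → Fin n → Act → State
  guard_local : ∀ (x y : Fin n → State) (p : Fin n) (a : Act), x p = y p →
    (∀ q, G.Adj p q → x q = y q) → (guard x p a ↔ guard y p a)
  stmt_local : ∀ (x y : Fin n → State) (p : Fin n) (a : Act), x p = y p →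
    (∀ q, G.Adj p q → x q = y q) → stmt x p a = stmt y p a
  nextHop : Fin n → State → Fin n → Fin n
  nextHop_adj : ∀ p x d, G.Adj p (nextHop p x d)

namespace RoutingAlgorithm

variable {n : ℕ} {G : SimpleGraph (Fin n)} (A : RoutingAlgorithm G)

/-- No action of the routing algorithm is enabled. -/
def Terminal (x : Fin n → A.State) : Prop := ∀ p a, ¬ A.guard x p a

/-- The routing tables are correct: they induce paths with a minimal number of edges. -/
def CorrectTables (x : Fin n → A.State) : Prop :=
  ∀ p d, p ≠ d → G.dist (A.nextHop p (x p) d) d + 1 = G.dist p d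

/-- Executions of the routing algorithm alone, from an arbitrary configuration, under a distributed
weakly fair daemon. A finite maximal execution is continued by repeating its terminal
configuration for ever. -/
structure IsExecution (conf : ℕ → Fin n → A.State) (sel : ℕ → Fin n → Option A.Act) : Prop where
  sel_enabled : ∀ t p a, sel t p = some a → A.guard (conf t) p a
  sel_nonempty : ∀ t, (∃ p a, A.guard (conf t) p a) → ∃ p, sel t p ≠ none
  idle : ∀ t p, sel t p = none → conf (t + 1) p = conf t p
  move : ∀ t p a, sel t p = some a → conf (t + 1) p = A.stmt (conf t) p a
  fair : WeaklyFair (fun t => A.guard (conf t)) sel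

/-- Every execution reaches within `R` rounds a configuration in which the routing tables are
correct and no action is enabled. -/
def StabilizesWithin (R : ℕ) : Prop :=
  ∀ conf sel, A.IsExecution conf sel →
    ∃ t, WithinRounds (fun t => A.guard (conf t)) sel 0 t R ∧
      A.Terminal (conf t) ∧ A.CorrectTables (conf t)

/-- The algorithm is silent and self-stabilizing for the computation of routing tables, and `R` is
its stabilization time in rounds. -/
def IsStabilizationTime (R : ℕ) : Prop := IsLeast {R | A.StabilizesWithin R} R

end RoutingAlgorithm

/-! ## The message forwarding protocol -/

/-- Types of messages: sending, acknowledgment, fail. -/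
inductive Kind
  | S
  | A
  | F

/-- A message `(m, r, q, d, c)`: useful information, next processor, last processor, destination,
type. -/
structure Msg (n : ℕ) (M : Type) where
  info : M
  next : Fin n
  last : Fin n
  dest : Fin n
  kind : Kind

/-- A configuration. `buf p i` is the buffer of rank `i` of `p` (only the ranks `1, …, D + 1` are
used), `none` being the empty buffer; `request p` is the request variable of `p`;
`waiting p` is `some (m, d)` if `m` is the message waiting in the higher layer of `p` and `d` its
destination, and `none` if there is no such message; `queue p i` is the queue that implements the
fair choice for the buffer of rank `i` of `p`; `rt` is the configuration of the routing
algorithm. -/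
structure Config {n : ℕ} {G : SimpleGraph (Fin n)} (A : RoutingAlgorithm G) (M : Type) where
  rt : Fin n → A.State
  buf : Fin n → ℕ → Option (Msg n M)
  request : Fin n → Bool
  waiting : Fin n → Option (M × Fin n)
  queue : Fin n → ℕ → List (Fin n)

/-- The names of the rules of the forwarding protocol. -/
inductive Rule
  | R1 | R2 | R3 | R4 | R5 | R6 | R7 | R8 | R9
  | R10 | R11 | R12 | R13 | R14 | R15 | R16 | R17 | R18

section Protocol

variable {n : ℕ} {G : SimpleGraph (Fin n)} {A : RoutingAlgorithm G} {M : Type}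

namespace Config

/-- The next hop from `p` towards `d` given by the current routing table of `p`. -/
def hop (γ : Config A M) (p d : Fin n) : Fin n := A.nextHop p (γ.rt p) d

/-- `s` is a processor which can send a message in the buffer of rank `i` of `p`. -/
def Candidate (γ : Config A M) (p : Fin n) (i : ℕ) (s : Fin n) : Prop :=
  G.Adj p s ∧ ∃ m q d, γ.buf s (i - 1) = some ⟨m, p, q, d, .S⟩ ∧ s ≠ d

/-- The choice for the buffer of rank `i` of `p`: the head of the queue. -/
def choice (γ : Config A M) (p : Fin n) (i : ℕ) : Option (Fin n) := (γ.queue p i).head?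

/-- The variables lie in their domains (the fields `r` and `q` of a message stored at `p` are
neighbours of `p`), and the queues contain, once each, exactly the processors that can send a
message in the buffer. -/
structure Valid (γ : Config A M) : Prop where
  next_adj : ∀ p i μ, γ.buf p i = some μ → G.Adj p μ.next
  last_adj : ∀ p i μ, γ.buf p i = some μ → G.Adj p μ.last
  queue_nodup : ∀ p i, 2 ≤ i → i ≤ G.diam + 1 → (γ.queue p i).Nodup
  mem_queue : ∀ p i s, 2 ≤ i → i ≤ G.diam + 1 → (s ∈ γ.queue p i ↔ γ.Candidate p i s)

/-- `γ.Fires p k i b`: the guard of rule `k` of processor `p`, for the buffer of rank `i`, holds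
in `γ`, and its statement assigns the content `b` to this buffer. (Every rule writes exactly one
buffer. In addition `R1` sets the request variable to false, see `Step` below, and
`R4`, `R10` deliver the message to the higher layer, which does not affect the variables.) -/
inductive Fires (γ : Config A M) (p : Fin n) : Rule → ℕ → Option (Msg n M) → Prop
  | r1 (m : M) (r d : Fin n) : γ.request p = true → γ.buf p 1 = none →
      γ.waiting p = some (m, d) →
      (∀ r' c, γ.buf (γ.hop p d) 2 ≠ some ⟨m, r', p, d, c⟩) → G.Adj p r →
      Fires γ p .R1 1 (some ⟨m, γ.hop p d, r, d, .S⟩)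
  | r2 (m : M) (r q d : Fin n) : γ.buf p 1 = some ⟨m, r, q, d, .F⟩ → d ≠ p →
      (∀ r', γ.buf r 2 ≠ some ⟨m, r', p, d, .F⟩) →
      Fires γ p .R2 1 (some ⟨m, γ.hop p d, q, d, .S⟩)
  | r3 (m : M) (r q d : Fin n) : γ.buf p 1 = some ⟨m, r, q, d, .A⟩ → d ≠ p →
      (∀ r', γ.buf r 2 ≠ some ⟨m, r', p, d, .A⟩) →
      Fires γ p .R3 1 none
  | r4 (m : M) (r q : Fin n) : γ.buf p 1 = some ⟨m, r, q, p, .S⟩ →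
      Fires γ p .R4 1 (some ⟨m, r, q, p, .A⟩)
  | r5 (m : M) (r q : Fin n) : γ.buf p 1 = some ⟨m, r, q, p, .A⟩ →
      Fires γ p .R5 1 none
  | r6 (m : M) (r q : Fin n) : γ.buf p 1 = some ⟨m, r, q, p, .F⟩ →
      Fires γ p .R6 1 (some ⟨m, r, q, p, .S⟩)
  | r7 (i : ℕ) (m : M) (r q d r' : Fin n) (c : Kind) : 1 ≤ i → i ≤ G.diam →
      γ.buf p i = some ⟨m, r, q, d, .S⟩ → p ≠ d →
      γ.buf r (i + 1) = some ⟨m, r', p, d, c⟩ → (c = .F ∨ c = .A) →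
      Fires γ p .R7 i (some ⟨m, r, q, d, c⟩)
  | r8 (i : ℕ) (m : M) (s q d : Fin n) : 2 ≤ i → i ≤ G.diam →
      γ.buf p i = none → γ.choice p i = some s →
      γ.buf s (i - 1) = some ⟨m, p, q, d, .S⟩ →
      (∀ r c, γ.buf (γ.hop p d) (i + 1) ≠ some ⟨m, r, p, d, c⟩) →
      Fires γ p .R8 i (some ⟨m, γ.hop p d, s, d, .S⟩)
  | r9 (i : ℕ) (m : M) (r q d q' : Fin n) (c : Kind) : 2 ≤ i → i ≤ G.diam →
      γ.buf p i = some ⟨m, r, q, d, c⟩ → (c = .F ∨ c = .A) → d ≠ p →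
      γ.buf q (i - 1) = some ⟨m, p, q', d, c⟩ →
      (∀ r', γ.buf r (i + 1) ≠ some ⟨m, r', p, d, c⟩) →
      Fires γ p .R9 i none
  | r10 (i : ℕ) (m : M) (r q : Fin n) : 2 ≤ i → i ≤ G.diam + 1 →
      γ.buf p i = some ⟨m, r, q, p, .S⟩ →
      Fires γ p .R10 i (some ⟨m, r, q, p, .A⟩)
  | r11 (i : ℕ) (m : M) (r q q' : Fin n) (c : Kind) : 2 ≤ i → i ≤ G.diam + 1 →
      γ.buf p i = some ⟨m, r, q, p, c⟩ → (c = .F ∨ c = .A) →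
      γ.buf q (i - 1) = some ⟨m, p, q', p, c⟩ →
      Fires γ p .R11 i none
  | r12 (m : M) (s q d : Fin n) : γ.buf p (G.diam + 1) = none →
      γ.choice p (G.diam + 1) = some s →
      γ.buf s G.diam = some ⟨m, p, q, d, .S⟩ →
      Fires γ p .R12 (G.diam + 1) (some ⟨m, γ.hop p d, s, d, .S⟩)
  | r13 (m : M) (r q d : Fin n) : γ.buf p (G.diam + 1) = some ⟨m, r, q, d, .S⟩ → d ≠ p →
      Fires γ p .R13 (G.diam + 1) (some ⟨m, r, q, d, .F⟩)
  | r14 (m : M) (r q d q' : Fin n) (c : Kind) :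
      γ.buf p (G.diam + 1) = some ⟨m, r, q, d, c⟩ → (c = .F ∨ c = .A) → d ≠ p →
      γ.buf q G.diam = some ⟨m, p, q', d, c⟩ →
      Fires γ p .R14 (G.diam + 1) none
  | r15 (i : ℕ) (m : M) (r q d : Fin n) (c : Kind) : 2 ≤ i → i ≤ G.diam →
      γ.buf p i = some ⟨m, r, q, d, c⟩ → (c = .F ∨ c = .A) →
      (∀ r', γ.buf r (i + 1) ≠ some ⟨m, r', p, d, c⟩) →
      (∀ q' c', γ.buf q (i - 1) ≠ some ⟨m, p, q', d, c'⟩) →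
      Fires γ p .R15 i none
  | r16 (i : ℕ) (m : M) (r q d q' : Fin n) (c c' : Kind) : 2 ≤ i → i ≤ G.diam →
      γ.buf p i = some ⟨m, r, q, d, c⟩ → (c = .F ∨ c = .A) →
      (∀ r', γ.buf r (i + 1) ≠ some ⟨m, r', p, d, c⟩) →
      γ.buf q (i - 1) = some ⟨m, p, q', d, c'⟩ →
      (((c' = .F ∨ c' = .A) ∧ c' ≠ c) ∨ q = d) →
      Fires γ p .R16 i none
  | r17 (m : M) (r q d : Fin n) (c : Kind) :
      γ.buf p (G.diam + 1) = some ⟨m, r, q, d, c⟩ → (c = .F ∨ c = .A) →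
      (∀ q' c', γ.buf q G.diam ≠ some ⟨m, p, q', d, c'⟩) →
      Fires γ p .R17 (G.diam + 1) none
  | r18 (m : M) (r q d q' : Fin n) (c c' : Kind) :
      γ.buf p (G.diam + 1) = some ⟨m, r, q, d, c⟩ → (c = .F ∨ c = .A) →
      γ.buf q G.diam = some ⟨m, p, q', d, c'⟩ →
      (((c' = .F ∨ c' = .A) ∧ c' ≠ c) ∨ q = d) →
      Fires γ p .R18 (G.diam + 1) none

end Config

/-- The actions of the composed system: those of the routing algorithm, and the rules of the
forwarding protocol together with the rank of the buffer to which they are applied. -/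
abbrev Action (A : RoutingAlgorithm G) : Type := A.Act ⊕ (Rule × ℕ)

/-- Enabled actions of the composed system. The routing algorithm has priority: a processor with an
enabled routing action cannot execute a rule of the forwarding protocol. -/
def Enabled (γ : Config A M) (p : Fin n) : Action A → Prop
  | .inl a => A.guard γ.rt p a
  | .inr (k, i) => (∃ b, γ.Fires p k i b) ∧ ∀ a, ¬ A.guard γ.rt p a

/-- The sending rule. -/
def sendAction : Action A := .inr (.R1, 1)

/-- What the higher layer of one processor may do to the request variable and to the waiting
message: a waiting message stays until it is sent out and a request is not withdrawn; a new
message may arrive when none is waiting; the request may be raised when it is false and a message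
is waiting. -/
def HigherLayer (req : Bool) (w : Option (M × Fin n)) (req' : Bool) (w' : Option (M × Fin n)) :
    Prop :=
  (w ≠ none → w' = w) ∧ (req = true → req' = true) ∧ (req = false → req' = true → w' ≠ none)

open Classical in
/-- One step of the composed system in which each processor `p` executes `sel p`, followed by an
arbitrary move of the higher layers. The queues are first-in first-out: the processors which still
satisfy the predicate keep their order and precede the new ones. -/
structure Step (γ : Config A M) (sel : Fin n → Option (Action A)) (γ' : Config A M) : Prop where
  sel_enabled : ∀ p a, sel p = some a → Enabled γ p a
  sel_nonempty : (∃ p a, Enabled γ p a) → ∃ p, sel p ≠ none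
  rt_move : ∀ p a, sel p = some (.inl a) → γ'.rt p = A.stmt γ.rt p a
  rt_idle : ∀ p, (∀ a, sel p ≠ some (.inl a)) → γ'.rt p = γ.rt p
  buf_move : ∀ p k i, sel p = some (.inr (k, i)) →
    ∃ b, γ.Fires p k i b ∧ γ'.buf p = Function.update (γ.buf p) i b
  buf_idle : ∀ p, (∀ k i, sel p ≠ some (.inr (k, i))) → γ'.buf p = γ.buf p
  higher_send : ∀ p, sel p = some sendAction →
    HigherLayer false none (γ'.request p) (γ'.waiting p)
  higher_idle : ∀ p, sel p ≠ some sendAction →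
    HigherLayer (γ.request p) (γ.waiting p) (γ'.request p) (γ'.waiting p)
  queue_fifo : ∀ p i, 2 ≤ i → i ≤ G.diam + 1 →
    (γ.queue p i).filter (fun s => decide (γ'.Candidate p i s)) <+: γ'.queue p i

end Protocol

/-- Executions of the forwarding protocol running simultaneously with the routing algorithm `A`,
from an arbitrary configuration, under a distributed weakly fair daemon. If no action is enabled,
the system idles until a higher layer raises a request. -/
structure Execution {n : ℕ} {G : SimpleGraph (Fin n)} (A : RoutingAlgorithm G) (M : Type) where
  conf : ℕ → Config A M
  sel : ℕ → Fin n → Option (Action A)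
  valid : ∀ t, (conf t).Valid
  step : ∀ t, Step (conf t) (sel t) (conf (t + 1))
  fair : WeaklyFair (fun t => Enabled (conf t)) sel

namespace Execution

variable {n : ℕ} {G : SimpleGraph (Fin n)} {A : RoutingAlgorithm G} {M : Type}

/-- Processor `p` emits a message in the step that leaves configuration `t`. -/
def Emits (e : Execution A M) (p : Fin n) (t : ℕ) : Prop := e.sel t p = some sendAction

/-- In configuration `t`, a message is waiting at `p` and its emission is requested. -/
def Pending (e : Execution A M) (p : Fin n) (t : ℕ) : Prop :=
  (e.conf t).request p = true ∧ (e.conf t).waiting p ≠ none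

/-- Counted from configuration `t`, processor `p` emits a message, and the first such emission is
completed within `k` rounds. -/
def EmitsWithin (e : Execution A M) (p : Fin n) (t k : ℕ) : Prop :=
  ∃ u, t ≤ u ∧ e.Emits p u ∧ (∀ v, t ≤ v → v < u → ¬ e.Emits p v) ∧
    WithinRounds (fun t => Enabled (e.conf t)) e.sel t (u + 1) k

/-- The delay of `p` is at most `k` rounds: if a message is pending at `p` before any emission of
`p`, then the first emission of `p` occurs within `k` rounds. -/
def DelayAtMost (e : Execution A M) (p : Fin n) (k : ℕ) : Prop :=
  ∀ t, e.Pending p t → (∀ v < t, ¬ e.Emits p v) → e.EmitsWithin p t k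

/-- The waiting time of `p` is at most `k` rounds: if `p` has emitted a message in the step leaving
configuration `s`, and in a later configuration `t` (for instance `t = s + 1`) the next message is
pending and not yet emitted, then this next emission occurs within `k` rounds from `t`. -/
def WaitingTimeAtMost (e : Execution A M) (p : Fin n) (k : ℕ) : Prop :=
  ∀ s t, s < t → e.Emits p s → (∀ v, s < v → v < t → ¬ e.Emits p v) → e.Pending p t →
    e.EmitsWithin p t k

end Execution

end SSMFP

/-! From any configuration with a pending request, whatever happened before, an emission follows
within `R` plus O(nDΔ^D) rounds; delay and waiting time are two instances of this. Time is counted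
with `Reaches`. The end of a round is monotone in its start, so bounds for successive phases add up
even though their rounds are not aligned.

The routing moves of the composed system form an execution of the routing algorithm alone, and its
rounds are not slower there. Hence after `R` rounds the tables are correct and frozen
(`exists_stabilized`).

The rest is an induction on the rank, from D + 1 downwards. A buffer of rank at least 2 is `Good`
when its content really comes from its last processor. Goodness is invariant and trivial for empty
buffers, so each buffer only has to be emptied once (`reaches_goodFrom`). At rank D + 1 a message is
answered (type `A` or `F`) in one round. At a lower rank it waits in the queue behind at most Δ - 1
competitors, each of which blocks the buffer for the answering time of the next rank plus an erasing
time linear in the number of higher ranks. This recurrence, with leading factor Δ (`Relays.pred`),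
yields Δ^D.

It remains to empty the buffer of rank 1. An acknowledged message is erased; a failed one is sent
again. Along correct tables the distance to the destination drops with each hop, so a message sent
afresh arrives by rank D + 1 and cannot fail (`Step.noFail`). One retry therefore suffices
(`reaches_none`), and then `R1` stays enabled until it is executed (`reaches_emission`). -/

namespace SSMFP

/-! ### Rounds and bounded reachability. -/

section Scheduling

variable {P α : Type} {en : ℕ → P → α → Prop} {ex : ℕ → P → Option α}

/-- Every action enabled in configuration `s` is executed or neutralized before configuration
`t`. -/
def Covers (en : ℕ → P → α → Prop) (ex : ℕ → P → Option α) (s t : ℕ) : Prop :=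
  ∀ p a, en s p a → ∃ u, s ≤ u ∧ u < t ∧ (ex u p = some a ∨ ¬ en (u + 1) p a)

/-- The end of the round that starts with configuration `s`. -/
noncomputable def roundEnd (en : ℕ → P → α → Prop) (ex : ℕ → P → Option α) (s : ℕ) : ℕ :=
  sInf {t | s < t ∧ Covers en ex s t}

/-- The daemon is weakly fair and finitely many actions are enabled in every configuration. -/
structure FinitelyFair (en : ℕ → P → α → Prop) (ex : ℕ → P → Option α) : Prop where
  fair : WeaklyFair en ex
  finite : ∀ t, {x : P × α | en t x.1 x.2}.Finite

namespace FinitelyFair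

theorem exists_covers (h : FinitelyFair en ex) (s : ℕ) : ∃ t, s < t ∧ Covers en ex s t := by
  have key : ∀ x : P × α, en s x.1 x.2 →
      ∃ u, s ≤ u ∧ (ex u x.1 = some x.2 ∨ ¬ en (u + 1) x.1 x.2) := by
    intro x hx
    obtain ⟨u, hu, h1 | h1⟩ := h.fair s x.1 x.2 hx
    · exact ⟨u, hu, .inl h1⟩
    · rcases Nat.eq_or_lt_of_le hu with rfl | hlt
      · exact absurd hx h1
      -- Fairness gives a configuration `u` where the action is disabled; a neutralization is dated
      -- by the step leading to it, hence `u - 1`.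
      · refine ⟨u - 1, by omega, .inr ?_⟩
        rwa [show u - 1 + 1 = u by omega]
  choose! g hg using key
  obtain ⟨b, hb⟩ := ((h.finite s).image g).bddAbove
  refine ⟨max s b + 1, by omega, fun p a hpa =>
    ⟨g (p, a), (hg (p, a) hpa).1, ?_, (hg (p, a) hpa).2⟩⟩
  have : g (p, a) ≤ b := hb ⟨(p, a), hpa, rfl⟩
  omega

theorem isRound_roundEnd (h : FinitelyFair en ex) (s : ℕ) :
    IsRound en ex s (roundEnd en ex s) :=
  ⟨Nat.sInf_mem (h.exists_covers s), fun _ ht => Nat.sInf_le ht⟩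

theorem lt_roundEnd (h : FinitelyFair en ex) (s : ℕ) : s < roundEnd en ex s :=
  (h.isRound_roundEnd s).1.1

theorem covers_roundEnd (h : FinitelyFair en ex) (s : ℕ) : Covers en ex s (roundEnd en ex s) :=
  (h.isRound_roundEnd s).1.2

/-- An action enabled at `s` and untouched until `t` is still enabled at `t`, so the round starting
at `t` also deals with it. -/
theorem roundEnd_mono (h : FinitelyFair en ex) : Monotone (roundEnd en ex) := by
  intro s t hst
  refine Nat.sInf_le ⟨lt_of_le_of_lt hst (h.lt_roundEnd t), fun p a hpa => ?_⟩
  by_contra hcon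
  push Not at hcon
  have hen : ∀ v, s ≤ v → v ≤ t → en v p a := by
    intro v hv
    induction v, hv using Nat.le_induction with
    | base => exact fun _ => hpa
    | succ v hv _ => exact fun hvt => (hcon v hv (by have := h.lt_roundEnd t; omega)).2
  obtain ⟨u, hu, hlt, hor⟩ := h.covers_roundEnd t p a (hen t hst le_rfl)
  have := hcon u (hst.trans hu) hlt
  tauto

theorem iterate_mono (h : FinitelyFair en ex) (k : ℕ) : Monotone (roundEnd en ex)^[k] :=
  h.roundEnd_mono.iterate k

theorem le_iterate (h : FinitelyFair en ex) (k s : ℕ) : s ≤ (roundEnd en ex)^[k] s := by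
  induction k with
  | zero => rfl
  | succ k ih =>
    rw [Function.iterate_succ_apply']
    exact ih.trans (h.lt_roundEnd _).le

theorem iterate_le_iterate (h : FinitelyFair en ex) {k l : ℕ} (hkl : k ≤ l) (s : ℕ) :
    (roundEnd en ex)^[k] s ≤ (roundEnd en ex)^[l] s := by
  obtain ⟨m, rfl⟩ := Nat.exists_eq_add_of_le' hkl
  rw [Function.iterate_add_apply]
  exact h.le_iterate m _

theorem withinRounds (h : FinitelyFair en ex) {s t k : ℕ} (ht : t ≤ (roundEnd en ex)^[k] s) :
    WithinRounds en ex s t k := by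
  refine ⟨fun j => (roundEnd en ex)^[j] s, rfl, fun j _ => ?_, ht⟩
  simp only [Function.iterate_succ_apply']
  exact h.isRound_roundEnd _

end FinitelyFair

/-- From configuration `t`, a configuration satisfying `Q` is reached within `k` rounds. -/
def Reaches (en : ℕ → P → α → Prop) (ex : ℕ → P → Option α) (k t : ℕ) (Q : ℕ → Prop) : Prop :=
  ∃ u, t ≤ u ∧ u ≤ (roundEnd en ex)^[k] t ∧ Q u

namespace Reaches

variable {k l t : ℕ} {Q R I J : ℕ → Prop}

theorem refl (h : Q t) : Reaches en ex 0 t Q := ⟨t, le_rfl, le_rfl, h⟩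

theorem mono_right (h : Reaches en ex k t Q) (hQR : ∀ u, Q u → R u) : Reaches en ex k t R := by
  obtain ⟨u, h1, h2, h3⟩ := h
  exact ⟨u, h1, h2, hQR u h3⟩

theorem mono (h : Reaches en ex k t Q) (hf : FinitelyFair en ex) (hkl : k ≤ l) :
    Reaches en ex l t Q := by
  obtain ⟨u, h1, h2, h3⟩ := h
  exact ⟨u, h1, h2.trans (hf.iterate_le_iterate hkl t), h3⟩

/-- The rounds of the second phase start at `u`, possibly in the middle of a round of the first;
monotonicity of round ends absorbs the misalignment. -/
theorem trans (h : Reaches en ex k t Q) (hf : FinitelyFair en ex)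
    (hQR : ∀ u, t ≤ u → Q u → Reaches en ex l u R) : Reaches en ex (k + l) t R := by
  obtain ⟨u, h1, h2, h3⟩ := h
  obtain ⟨v, h4, h5, h6⟩ := hQR u h1 h3
  refine ⟨v, h1.trans h4, h5.trans ?_, h6⟩
  rw [Nat.add_comm, Function.iterate_add_apply]
  exact hf.iterate_mono l h2

/-- A property that can only be left through `J` still holds when `Q` is reached, unless `J` is
reached before. -/
theorem stays_or (h : Reaches en ex k t Q) (hI : I t)
    (hstep : ∀ v, t ≤ v → I v → I (v + 1) ∨ J (v + 1)) :
    Reaches en ex k t (fun u => (Q u ∧ I u) ∨ J u) := by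
  obtain ⟨u, h1, h2, h3⟩ := h
  have : ∀ w, t ≤ w → I w ∨ ∃ v, t ≤ v ∧ v ≤ w ∧ J v := by
    intro w hw
    induction w, hw using Nat.le_induction with
    | base => exact .inl hI
    | succ w hw ih =>
      rcases ih with ih | ⟨v, hv, hvw, hJ⟩
      · rcases hstep w hw ih with h | h
        · exact .inl h
        · exact .inr ⟨w + 1, by omega, le_rfl, h⟩
      · exact .inr ⟨v, hv, by omega, hJ⟩
  rcases this u h1 with h | ⟨v, hv, hvu, hJ⟩
  · exact ⟨u, h1, h2, .inl ⟨h3, h⟩⟩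
  · exact ⟨v, hv, hvu.trans h2, .inr hJ⟩

/-- If an action is enabled as long as `I` holds, if `I` can only be left through `Q`, and if the
execution of the action leads to `Q`, then `Q` is reached within one round. -/
theorem ensures (hf : FinitelyFair en ex) (p : P) (a : α) (hI : I t)
    (hen : ∀ v, t ≤ v → I v → en v p a)
    (hex : ∀ v, t ≤ v → I v → ex v p = some a → Q (v + 1))
    (hstep : ∀ v, t ≤ v → I v → I (v + 1) ∨ Q (v + 1)) : Reaches en ex 1 t Q := by
  obtain ⟨u, h1, h2, h3⟩ := hf.covers_roundEnd t p a (hen t le_rfl hI)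
  by_contra hcon
  have hno : ∀ v, t ≤ v → v ≤ u + 1 → ¬ Q v := fun v hv hvu hQ =>
    hcon ⟨v, hv, hvu.trans h2, hQ⟩
  have hall : ∀ v, t ≤ v → v ≤ u + 1 → I v := by
    intro v hv
    induction v, hv using Nat.le_induction with
    | base => exact fun _ => hI
    | succ v hv ih =>
      intro hvu
      exact (hstep v hv (ih (by omega))).resolve_right (hno _ (by omega) hvu)
  rcases h3 with h3 | h3
  · exact hno (u + 1) (by omega) le_rfl (hex u h1 (hall u h1 (by omega)) h3)
  · exact h3 (hen _ (by omega) (hall (u + 1) (by omega) le_rfl))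

end Reaches

theorem FinitelyFair.roundEnd_add {s : ℕ}
    (hf : FinitelyFair (fun v => en (s + v)) (fun v => ex (s + v))) (t : ℕ) :
    roundEnd en ex (s + t) = s + roundEnd (fun v => en (s + v)) (fun v => ex (s + v)) t := by
  have hcov : ∀ w, Covers en ex (s + t) (s + w) ↔
      Covers (fun v => en (s + v)) (fun v => ex (s + v)) t w := by
    intro w
    refine forall₃_congr fun p a _ => ⟨?_, ?_⟩
    · rintro ⟨u, h1, h2, h3⟩
      refine ⟨u - s, by omega, by omega, ?_⟩
      have e1 : s + (u - s) = u := by omega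
      have e2 : s + (u - s + 1) = u + 1 := by omega
      simpa only [e1, e2] using h3
    · rintro ⟨u, h1, h2, h3⟩
      exact ⟨s + u, by omega, by omega, h3⟩
  unfold roundEnd
  have hset : {w | s + t < w ∧ Covers en ex (s + t) w} = (fun w => s + w) ''
      {w | t < w ∧ Covers (fun v => en (s + v)) (fun v => ex (s + v)) t w} := by
    ext w
    constructor
    · rintro ⟨h1, h2⟩
      obtain ⟨x, rfl⟩ : ∃ x, w = s + x := ⟨w - s, by omega⟩
      exact ⟨x, ⟨by omega, (hcov x).1 h2⟩, rfl⟩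
    · rintro ⟨x, ⟨h1, h2⟩, rfl⟩
      exact ⟨by dsimp only; omega, (hcov x).2 h2⟩
  rw [hset]
  have h : {w | t < w ∧ Covers (fun v => en (s + v)) (fun v => ex (s + v)) t w}.Nonempty :=
    hf.exists_covers t
  apply le_antisymm
  · exact Nat.sInf_le ⟨_, Nat.sInf_mem h, rfl⟩
  · refine le_csInf (h.image _) ?_
    rintro _ ⟨x, hx, rfl⟩
    exact Nat.add_le_add_left (Nat.sInf_le hx) s

theorem FinitelyFair.iterate_add {s : ℕ}
    (hf : FinitelyFair (fun v => en (s + v)) (fun v => ex (s + v))) (k t : ℕ) :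
    (roundEnd en ex)^[k] (s + t) =
      s + (roundEnd (fun v => en (s + v)) (fun v => ex (s + v)))^[k] t := by
  induction k generalizing t with
  | zero => rfl
  | succ k ih => rw [Function.iterate_succ_apply, Function.iterate_succ_apply, hf.roundEnd_add, ih]

end Scheduling

/-! ### The routing algorithm inside the composed system. -/

section Forwarding

variable {n : ℕ} {G : SimpleGraph (Fin n)} {A : RoutingAlgorithm G} {M : Type}

theorem Config.Fires.rank_le {γ : Config A M} {p : Fin n} {k : Rule} {i : ℕ}
    {b : Option (Msg n M)} (h : γ.Fires p k i b) : i ≤ G.diam + 1 := by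
  cases h <;> omega

namespace Execution

variable (e : Execution A M)

/-- Enabled actions in the `t`-th configuration. -/
abbrev en (t : ℕ) : Fin n → Action A → Prop := Enabled (e.conf t)

theorem finitelyFair : FinitelyFair e.en e.sel where
  fair := e.fair
  finite t := by
    have := A.act_finite
    have hr : Finite Rule := Finite.of_injective (β := Fin 18)
      (fun r => ⟨r.ctorIdx, by cases r <;> decide⟩) (by
        intro a b hab
        have : a.ctorIdx = b.ctorIdx := congrArg Fin.val hab
        cases a <;> cases b <;> first | rfl | (exact absurd this (by decide)))
    have hfin : (Set.range (Sum.elim (fun a : A.Act => (Sum.inl a : Action A))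
        (fun x : Rule × Fin (G.diam + 2) => Sum.inr (x.1, x.2.val)))).Finite := Set.finite_range _
    refine (Set.finite_univ.prod hfin).subset ?_
    rintro ⟨p, a | ⟨k, i⟩⟩ hx
    · exact ⟨trivial, .inl a, rfl⟩
    · obtain ⟨⟨b, hb⟩, -⟩ := hx
      exact ⟨trivial, .inr (k, ⟨i, by have := hb.rank_le; omega⟩), rfl⟩

/-- The execution from configuration `s` on. -/
def drop (s : ℕ) : Execution A M where
  conf t := e.conf (s + t)
  sel t := e.sel (s + t)
  valid t := e.valid (s + t)
  step t := e.step (s + t)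
  fair t p a h := by
    obtain ⟨u, hu, h⟩ := e.fair (s + t) p a h
    obtain ⟨v, rfl⟩ : ∃ v, u = s + v := ⟨u - s, by omega⟩
    exact ⟨v, by omega, h⟩

theorem rt_succ {t : ℕ} (h : ∀ p a, e.sel t p ≠ some (.inl a)) :
    (e.conf (t + 1)).rt = (e.conf t).rt :=
  funext fun p => (e.step t).rt_idle p (h p)

theorem rt_succ_of_terminal {t : ℕ} (h : A.Terminal (e.conf t).rt) :
    (e.conf (t + 1)).rt = (e.conf t).rt :=
  e.rt_succ fun p a hs => h p a ((e.step t).sel_enabled p _ hs)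

theorem rt_of_terminal {s t : ℕ} (h : A.Terminal (e.conf s).rt) (hst : s ≤ t) :
    (e.conf t).rt = (e.conf s).rt := by
  induction t, hst using Nat.le_induction with
  | base => rfl
  | succ t _ ih => rw [e.rt_succ_of_terminal (ih ▸ h), ih]

/-- The step that leaves configuration `t` is one of the routing algorithm (possibly idling in a
terminal configuration). -/
def RoutingStep (t : ℕ) : Prop :=
  (∃ p a, e.sel t p = some (.inl a)) ∨ A.Terminal (e.conf t).rt

theorem rt_eq_of_no_routingStep {s t : ℕ} (hst : s ≤ t)
    (h : ∀ v, s ≤ v → v < t → ¬ e.RoutingStep v) : (e.conf t).rt = (e.conf s).rt := by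
  induction t, hst using Nat.le_induction with
  | base => rfl
  | succ t hst ih =>
    rw [e.rt_succ, ih fun v h1 h2 => h v h1 (by omega)]
    intro p a hs
    exact h t hst (by omega) (.inl ⟨p, a, hs⟩)

/-- Without further routing steps the tables would be frozen in a non-terminal configuration, and an
action enabled there would stay enabled for ever without being executed. So the routing steps can be
enumerated by ℕ. -/
theorem infinite_routingStep : {t | e.RoutingStep t}.Infinite := by
  rw [Set.infinite_iff_exists_gt]
  intro s
  by_contra hcon
  push Not at hcon
  have hno : ∀ v, s + 1 ≤ v → ¬ e.RoutingStep v := fun v hv h => by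
    have := hcon v h; omega
  have hrt : ∀ v, s + 1 ≤ v → (e.conf v).rt = (e.conf (s + 1)).rt := fun v hv =>
    e.rt_eq_of_no_routingStep hv fun w hw _ => hno w hw
  have hnt : ¬ A.Terminal (e.conf (s + 1)).rt := fun h => hno _ le_rfl (.inr h)
  unfold RoutingAlgorithm.Terminal at hnt
  push Not at hnt
  obtain ⟨p, a, ha⟩ := hnt
  obtain ⟨u, hu, h | h⟩ := e.fair (s + 1) p (.inl a) ha
  · exact hno u hu (.inl ⟨p, a, h⟩)
  · exact h (show A.guard (e.conf u).rt p a by rw [hrt u hu]; exact ha)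

/-- The number of routing steps before configuration `t`. -/
noncomputable def routingCount (t : ℕ) : ℕ := by
  classical exact Nat.count e.RoutingStep t

/-- The configuration in which the `k`-th routing step occurs. -/
noncomputable def routingTime (k : ℕ) : ℕ := Nat.nth e.RoutingStep k

theorem routingStep_routingTime (k : ℕ) : e.RoutingStep (e.routingTime k) :=
  Nat.nth_mem_of_infinite e.infinite_routingStep k

theorem routingTime_strictMono : StrictMono e.routingTime :=
  Nat.nth_strictMono e.infinite_routingStep

theorem routingCount_le_iff {t k : ℕ} : e.routingCount t ≤ k ↔ t ≤ e.routingTime k := by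
  classical exact Nat.count_le_iff_le_nth e.infinite_routingStep

theorem routingCount_mono : Monotone e.routingCount := by
  classical exact Nat.count_monotone _

theorem routingTime_routingCount {t : ℕ} (h : e.RoutingStep t) :
    e.routingTime (e.routingCount t) = t := by
  classical exact Nat.nth_count h

theorem routingCount_routingTime (k : ℕ) : e.routingCount (e.routingTime k) = k := by
  classical exact Nat.count_nth_of_infinite e.infinite_routingStep k

theorem routingCount_lt {s t : ℕ} (h : e.RoutingStep s) (hst : s < t) :
    e.routingCount s < e.routingCount t := by
  classical exact Nat.count_strict_mono h hst

theorem rt_routingTime {s : ℕ} :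
    (e.conf (e.routingTime (e.routingCount s))).rt = (e.conf s).rt := by
  refine e.rt_eq_of_no_routingStep (e.routingCount_le_iff.1 le_rfl) fun v h1 h2 h => ?_
  have h3 := e.routingCount_lt h (Nat.lt_add_one v)
  have h4 := e.routingCount_mono h1
  have h5 := e.routingCount_mono (show v + 1 ≤ e.routingTime (e.routingCount s) by omega)
  rw [routingCount_routingTime] at h5
  omega

/-- The moves of the routing algorithm in the step that leaves configuration `t`. -/
def routingSel (t : ℕ) (p : Fin n) : Option A.Act := (e.sel t p).bind Sum.getLeft?

theorem routingSel_eq_some {t : ℕ} {p : Fin n} {a : A.Act} :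
    e.routingSel t p = some a ↔ e.sel t p = some (.inl a) := by
  unfold routingSel
  rcases e.sel t p with _ | (b | b) <;> simp

theorem routingSel_eq_none {t : ℕ} {p : Fin n} :
    e.routingSel t p = none ↔ ∀ a, e.sel t p ≠ some (.inl a) := by
  simp only [Option.eq_none_iff_forall_ne_some, ne_eq, routingSel_eq_some]

/-- Routing guards read only `rt`, which changes only in routing steps. Deleting all other steps
therefore keeps guards, moves and fairness. -/
theorem routing_isExecution :
    A.IsExecution (fun k => (e.conf (e.routingTime k)).rt) (fun k => e.routingSel (e.routingTime k))
      := by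
  have hnext : ∀ k, (e.conf (e.routingTime (k + 1))).rt = (e.conf (e.routingTime k + 1)).rt := by
    intro k
    have hc : e.routingCount (e.routingTime k + 1) = k + 1 := by
      apply le_antisymm
      · exact e.routingCount_le_iff.2 (e.routingTime_strictMono (Nat.lt_succ_self k))
      · have := e.routingCount_lt (e.routingStep_routingTime k) (Nat.lt_succ_self _)
        rw [routingCount_routingTime] at this
        exact this
    rw [← hc, rt_routingTime]
  refine ⟨?_, ?_, ?_, ?_, ?_⟩
  · intro k p a h
    exact (e.step _).sel_enabled p _ (e.routingSel_eq_some.1 h)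
  · rintro k ⟨p, a, h⟩
    rcases e.routingStep_routingTime k with ⟨q, b, hq⟩ | hT
    · exact ⟨q, by rw [e.routingSel_eq_some.2 hq]; simp⟩
    · exact absurd h (hT p a)
  · intro k p h
    rw [hnext]
    exact (e.step _).rt_idle p (e.routingSel_eq_none.1 h)
  · intro k p a h
    rw [hnext]
    exact (e.step _).rt_move p a (e.routingSel_eq_some.1 h)
  · intro k p a h
    obtain ⟨u, hu, h | h⟩ := e.fair (e.routingTime k) p (.inl a) h
    · have hs : e.RoutingStep u := .inl ⟨p, a, h⟩
      refine ⟨e.routingCount u, ?_, .inl ?_⟩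
      · have := e.routingCount_mono hu
        rwa [routingCount_routingTime] at this
      · change e.routingSel (e.routingTime (e.routingCount u)) p = some a
        rw [e.routingTime_routingCount hs]
        exact e.routingSel_eq_some.2 h
    · refine ⟨e.routingCount u, ?_, .inr ?_⟩
      · have := e.routingCount_mono hu
        rwa [routingCount_routingTime] at this
      · change ¬ A.guard (e.conf (e.routingTime (e.routingCount u))).rt p a
        rw [rt_routingTime]
        exact h

/-- `k` rounds of the composed system contain `k` rounds of the routing algorithm. -/
theorem routing_rounds {k t : ℕ}
    (h : WithinRounds (fun k => A.guard (e.conf (e.routingTime k)).rt)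
      (fun k => e.routingSel (e.routingTime k)) 0 t k) :
    t ≤ e.routingCount ((roundEnd e.en e.sel)^[k] 0) := by
  obtain ⟨b, hb0, hb, ht⟩ := h
  suffices H : ∀ j ≤ k, b j ≤ e.routingCount ((roundEnd e.en e.sel)^[j] 0) from
    ht.trans (H k le_rfl)
  intro j
  induction j with
  | zero => intro _; rw [hb0]; exact Nat.zero_le _
  | succ j ih =>
    intro hj
    have hle := ih (by omega)
    rw [Function.iterate_succ_apply']
    set s := (roundEnd e.en e.sel)^[j] 0 with hs
    set f := roundEnd e.en e.sel s with hf
    have hsf : s < f := e.finitelyFair.lt_roundEnd s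
    have hex : ∀ p a, A.guard (e.conf s).rt p a → ∃ w, e.routingCount s ≤ w ∧
        w < e.routingCount f ∧ (e.routingSel (e.routingTime w) p = some a ∨
          ¬ A.guard (e.conf (e.routingTime (w + 1))).rt p a) := by
      intro p a hpa
      obtain ⟨u, hsu, huf, h | h⟩ := e.finitelyFair.covers_roundEnd s p (.inl a) hpa
      · have hst : e.RoutingStep u := .inl ⟨p, a, h⟩
        refine ⟨e.routingCount u, e.routingCount_mono hsu, e.routingCount_lt hst huf, .inl ?_⟩
        rw [e.routingTime_routingCount hst]
        exact e.routingSel_eq_some.2 h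
      · have h1 := e.routingCount_mono (show s ≤ u + 1 by omega)
        have h2 := e.routingCount_mono (show u + 1 ≤ f by omega)
        have h3 : e.routingCount s ≠ e.routingCount (u + 1) := by
          intro heq
          apply h
          change A.guard (e.conf (u + 1)).rt p a
          rw [← e.rt_routingTime (s := u + 1), ← heq, rt_routingTime]
          exact hpa
        refine ⟨e.routingCount (u + 1) - 1, by omega, by omega, .inr ?_⟩
        rw [show e.routingCount (u + 1) - 1 + 1 = e.routingCount (u + 1) by omega, rt_routingTime]
        exact h
    -- A round is a nonempty segment, so the count must increase even if no routing action is
    -- enabled; idling in a terminal configuration counts as a routing step for this reason.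
    have hlt : e.routingCount s < e.routingCount f := by
      by_cases hT : A.Terminal (e.conf s).rt
      · exact e.routingCount_lt (.inr hT) hsf
      · unfold RoutingAlgorithm.Terminal at hT
        push Not at hT
        obtain ⟨p, a, hpa⟩ := hT
        obtain ⟨w, h1, h2, -⟩ := hex p a hpa
        omega
    -- By minimality of rounds it is enough that the segment up to `routingCount f` covers `b j`: an
    -- action surviving until `routingCount s` is enabled at `s`, and is dealt with before `f`.
    refine (hb j (by omega)).2 ⟨by omega, fun p a hpa => ?_⟩
    by_contra hcon
    push Not at hcon
    have hen : ∀ v, b j ≤ v → v ≤ e.routingCount s →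
        A.guard (e.conf (e.routingTime v)).rt p a := by
      intro v hv
      induction v, hv using Nat.le_induction with
      | base => exact fun _ => hpa
      | succ v hv _ => exact fun hvt => (hcon v hv (by omega)).2
    have hs2 := hen _ hle le_rfl
    rw [rt_routingTime] at hs2
    obtain ⟨w, h1, h2, h3⟩ := hex p a hs2
    have := hcon w (by omega) h2
    tauto

theorem exists_stabilized {R : ℕ} (hR : A.StabilizesWithin R) (s : ℕ) :
    Reaches e.en e.sel R s fun t => A.Terminal (e.conf t).rt ∧ A.CorrectTables (e.conf t).rt := by
  obtain ⟨k, hk, hT, hC⟩ := hR _ _ (e.drop s).routing_isExecution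
  have h1 := (e.drop s).routing_rounds hk
  set u := (roundEnd (e.drop s).en (e.drop s).sel)^[R] 0 with hu
  have h2 : ((e.drop s).conf u).rt = ((e.drop s).conf ((e.drop s).routingTime k)).rt := by
    rw [← (e.drop s).rt_routingTime (s := u)]
    exact (e.drop s).rt_of_terminal hT ((e.drop s).routingTime_strictMono.monotone h1)
  refine ⟨s + u, by omega, ?_, ?_, ?_⟩
  · have := (e.drop s).finitelyFair.iterate_add (en := e.en) (ex := e.sel) (s := s) R 0
    rw [Nat.add_zero] at this
    rw [this]
    rfl
  · change A.Terminal ((e.drop s).conf u).rt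
    rw [h2]; exact hT
  · change A.CorrectTables ((e.drop s).conf u).rt
    rw [h2]; exact hC

end Execution

/-! ### Transitions of a single buffer, and invariance of goodness. -/

theorem Kind.ne_S {c : Kind} : c ≠ .S ↔ c = .F ∨ c = .A := by cases c <;> simp

namespace Config

variable {γ γ' : Config A M}

/-- `γ.Holds p i m r d l c`: the buffer of rank `i` of `p` contains the message `m` with next
processor `r`, last processor `l`, destination `d` and type `c`. -/
abbrev Holds (γ : Config A M) (p : Fin n) (i : ℕ) (m : M) (r l d : Fin n) (c : Kind) : Prop :=
  γ.buf p i = some ⟨m, r, l, d, c⟩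

theorem Holds.inj {p : Fin n} {i : ℕ} {m m' : M} {r r' l l' d d' : Fin n} {c c' : Kind}
    (h : γ.Holds p i m r l d c) (h' : γ.Holds p i m' r' l' d' c') :
    m' = m ∧ r' = r ∧ l' = l ∧ d' = d ∧ c' = c := by
  rw [Holds, h] at h'
  simp only [Option.some.injEq, Msg.mk.injEq] at h'
  grind

/-- The buffer of rank `i` of `p` contains the message `m` of destination `d` received from
`l`, with type `c`. -/
def Received (γ : Config A M) (p : Fin n) (i : ℕ) (m : M) (l d : Fin n) (c : Kind) : Prop :=
  ∃ r, γ.buf p i = some ⟨m, r, l, d, c⟩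

/-- The buffer of rank `i` of `p` contains the message `m` of destination `d` and next processor
`r`, with type `c`. -/
def Offers (γ : Config A M) (p : Fin n) (i : ℕ) (m : M) (r d : Fin n) (c : Kind) : Prop :=
  ∃ l, γ.buf p i = some ⟨m, r, l, d, c⟩

/-- This lemma, `Fires.of_S` and `Fires.of_ne_S` sort the rules by the previous content of the
buffer. Nearly every safety argument below uses only these three summaries. -/
theorem Fires.of_none {p : Fin n} {k : Rule} {i : ℕ} {b : Option (Msg n M)}
    (h : γ.Fires p k i b) (hb : γ.buf p i = none) :
    ∃ m l d, b = some ⟨m, γ.hop p d, l, d, .S⟩ ∧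
      (i ≤ G.diam → ∀ c, ¬ γ.Received (γ.hop p d) (i + 1) m p d c) ∧
      (2 ≤ i → γ.choice p i = some l ∧ γ.Offers l (i - 1) m p d .S) := by
  unfold Received Offers
  cases h <;> simp_all

theorem Fires.of_S {p : Fin n} {k : Rule} {i : ℕ} {b : Option (Msg n M)} {m : M} {r l d : Fin n}
    (h : γ.Fires p k i b) (hb : γ.Holds p i m r l d .S) :
    ∃ c, c ≠ .S ∧ b = some ⟨m, r, l, d, c⟩ ∧
      ((p = d ∧ c = .A) ∨ (p ≠ d ∧ i = G.diam + 1 ∧ c = .F) ∨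
        (p ≠ d ∧ i ≤ G.diam ∧ γ.Received r (i + 1) m p d c)) := by
  unfold Received
  cases h <;> simp_all
  all_goals grind

/-- The last clause of the erasing case needs D ≥ 1: for D = 0 the rank 1 is also the top rank,
where `R14`, `R17` and `R18` may erase a failed message. -/
theorem Fires.of_ne_S {p : Fin n} {k : Rule} {i : ℕ} {b : Option (Msg n M)} {m : M}
    {r l d : Fin n} {c : Kind}
    (h : γ.Fires p k i b) (hb : γ.Holds p i m r l d c) (hc : c ≠ .S) :
    (p = d ∨ i = G.diam + 1 ∨ ¬ γ.Received r (i + 1) m p d c) ∧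
    ((b = none ∧ (2 ≤ i → l ≠ d → ¬ γ.Offers l (i - 1) m p d .S) ∧
        (1 ≤ G.diam → i = 1 → c = .A)) ∨
      (i = 1 ∧ c = .F ∧ ∃ r', b = some ⟨m, r', l, d, .S⟩ ∧
        (p = d ∧ r' = r ∨ p ≠ d ∧ r' = γ.hop p d))) := by
  unfold Received Offers
  cases h <;> simp_all [-SimpleGraph.diam_eq_zero]
  all_goals grind

/-- The content of the buffer of rank `j + 1` of `p` has been copied from its last processor `l`,
which is not its destination: either `l` still offers the message and is the head of the queue of
the buffer, or `l` has already taken over the type of the copy. -/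
def Good (γ : Config A M) (p : Fin n) (j : ℕ) : Prop :=
  ∀ m r l d c, γ.Holds p (j + 1) m r l d c → l ≠ d ∧
    ((γ.Offers l j m p d .S ∧ γ.choice p (j + 1) = some l) ∨ (c ≠ .S ∧ γ.Offers l j m p d c))

theorem good_of_none {p : Fin n} {j : ℕ} (h : γ.buf p (j + 1) = none) : γ.Good p j := by
  intro m r l d c hc
  simp [Holds, h] at hc

theorem Valid.candidate_of_choice (hv : γ.Valid) {p s : Fin n} {i : ℕ} (h2 : 2 ≤ i)
    (hD : i ≤ G.diam + 1) (h : γ.choice p i = some s) : γ.Candidate p i s :=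
  (hv.mem_queue p i s h2 hD).1 (List.mem_of_head? h)

theorem Offers.candidate {p l d : Fin n} {j : ℕ} {m : M} (h : γ.Offers l j m p d .S) (hld : l ≠ d)
    (hv : γ.Valid) : γ.Candidate p (j + 1) l := by
  obtain ⟨q, hq⟩ := h
  exact ⟨(hv.next_adj _ _ _ hq).symm, m, q, d, hq, hld⟩

theorem Candidate.ne_of_offers {p l d : Fin n} {j : ℕ} {m : M} {c : Kind}
    (h : γ.Candidate p (j + 1) l) (ho : γ.Offers l j m p d c) : c = .S ∧ l ≠ d := by
  obtain ⟨-, m', q, d', h, hne⟩ := h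
  obtain ⟨q', ho⟩ := ho
  rw [Nat.add_sub_cancel, ho] at h
  simp only [Option.some.injEq, Msg.mk.injEq] at h
  grind

end Config

namespace Step

variable {γ γ' : Config A M} {sel : Fin n → Option (Action A)}

theorem fires_of_sel (hs : Step γ sel γ') {p : Fin n} {k : Rule} {i : ℕ}
    (h : sel p = some (.inr (k, i))) : γ.Fires p k i (γ'.buf p i) := by
  obtain ⟨b, hb, heq⟩ := hs.buf_move p k i h
  rw [heq, Function.update_self]
  exact hb

theorem buf_cases (hs : Step γ sel γ') (p : Fin n) (i : ℕ) :
    γ'.buf p i = γ.buf p i ∨ ∃ k, γ.Fires p k i (γ'.buf p i) := by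
  by_cases h : ∃ k j, sel p = some (.inr (k, j))
  · obtain ⟨k, j, h⟩ := h
    by_cases hij : i = j
    · subst hij
      exact .inr ⟨k, hs.fires_of_sel h⟩
    · obtain ⟨b, -, heq⟩ := hs.buf_move p k j h
      left
      rw [heq, Function.update_of_ne hij]
  · push Not at h
    exact .inl (by rw [hs.buf_idle p h])

theorem of_none (hs : Step γ sel γ') {p : Fin n} {i : ℕ} (hb : γ.buf p i = none) :
    γ'.buf p i = none ∨ ∃ m l d, γ'.Holds p i m (γ.hop p d) l d .S ∧
      (i ≤ G.diam → ∀ c, ¬ γ.Received (γ.hop p d) (i + 1) m p d c) ∧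
      (2 ≤ i → γ.choice p i = some l ∧ γ.Offers l (i - 1) m p d .S) := by
  rcases hs.buf_cases p i with h | ⟨k, h⟩
  · exact .inl (h.trans hb)
  · exact .inr (h.of_none hb)

theorem of_S (hs : Step γ sel γ') {p : Fin n} {i : ℕ} {m : M} {r l d : Fin n}
    (hb : γ.Holds p i m r l d .S) :
    γ'.Holds p i m r l d .S ∨ ∃ c, c ≠ .S ∧ γ'.Holds p i m r l d c ∧
      ((p = d ∧ c = .A) ∨ (p ≠ d ∧ i = G.diam + 1 ∧ c = .F) ∨
        (p ≠ d ∧ i ≤ G.diam ∧ γ.Received r (i + 1) m p d c)) := by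
  rcases hs.buf_cases p i with h | ⟨k, h⟩
  · exact .inl (h.trans hb)
  · exact .inr (h.of_S hb)

theorem of_ne_S (hs : Step γ sel γ') {p : Fin n} {i : ℕ} {m : M} {r l d : Fin n} {c : Kind}
    (hb : γ.Holds p i m r l d c) (hc : c ≠ .S) :
    γ'.Holds p i m r l d c ∨
    ((p = d ∨ i = G.diam + 1 ∨ ¬ γ.Received r (i + 1) m p d c) ∧
      ((γ'.buf p i = none ∧ (2 ≤ i → l ≠ d → ¬ γ.Offers l (i - 1) m p d .S) ∧
          (1 ≤ G.diam → i = 1 → c = .A)) ∨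
        (i = 1 ∧ c = .F ∧ ∃ r', γ'.Holds p i m r' l d .S ∧
          (p = d ∧ r' = r ∨ p ≠ d ∧ r' = γ.hop p d)))) := by
  rcases hs.buf_cases p i with h | ⟨k, h⟩
  · exact .inl (h.trans hb)
  · exact .inr (h.of_ne_S hb hc)

theorem choice_eq (hs : Step γ sel γ') {p s : Fin n} {i : ℕ} (h2 : 2 ≤ i) (hD : i ≤ G.diam + 1)
    (h : γ.choice p i = some s) (hs' : γ'.Candidate p i s) : γ'.choice p i = some s := by
  classical
  have hp := hs.queue_fifo p i h2 hD
  unfold Config.choice at h ⊢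
  obtain ⟨t, ht⟩ := List.head?_eq_some_iff.1 h
  rw [ht, List.filter_cons_of_pos (by simpa using hs')] at hp
  obtain ⟨x, hx⟩ := hp
  rw [← hx]
  rfl

/-- Away from its destination and below the top rank, a message of type `S` can only change by `R7`,
which takes the type of the copy in the next buffer. -/
theorem offers_S (hs : Step γ sel γ') {p l d : Fin n} {j : ℕ} {m : M} (hj : j ≤ G.diam)
    (hld : l ≠ d) (h : γ.Offers l j m p d .S) :
    γ'.Offers l j m p d .S ∨
      ∃ c, c ≠ .S ∧ γ.Received p (j + 1) m l d c ∧ γ'.Offers l j m p d c := by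
  obtain ⟨q, h⟩ := h
  rcases hs.of_S h with h | ⟨c, hc, h, h1 | h1 | h1⟩
  · exact .inl ⟨q, h⟩
  · exact absurd h1.1 hld
  · omega
  · exact .inr ⟨c, hc, h1.2.2, q, h⟩

theorem offers_ne_S (hs : Step γ sel γ') {p l d : Fin n} {j : ℕ} {m : M} {c : Kind}
    (hj : j ≤ G.diam) (hld : l ≠ d) (hc : c ≠ .S) (h : γ.Offers l j m p d c)
    (hr : γ.Received p (j + 1) m l d c) : γ'.Offers l j m p d c := by
  obtain ⟨q, h⟩ := h
  rcases hs.of_ne_S h hc with h | ⟨h1 | h1 | h1, -⟩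
  · exact ⟨q, h⟩
  · exact absurd h1 hld
  · omega
  · exact absurd hr h1

/-- A new copy is made from the head of the queue, which remains the head while it offers the
message. The sender leaves type `S` only by adopting the type of the copy, and cannot drop that type
while the copy has it. -/
theorem good (hs : Step γ sel γ') (hv : γ.Valid) (hv' : γ'.Valid) {p : Fin n} {j : ℕ}
    (h1 : 1 ≤ j) (hD : j ≤ G.diam) (h : γ.Good p j) : γ'.Good p j := by
  have hch : ∀ {m l d}, γ'.Offers l j m p d .S → l ≠ d → γ.choice p (j + 1) = some l →
      γ'.choice p (j + 1) = some l := fun ho hld hc =>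
    hs.choice_eq (by omega) (by omega) hc (ho.candidate hld hv')
  have hup : ∀ {m r l d c}, γ.Holds p (j + 1) m r l d c →
      ∀ {r' c'}, γ'.Holds p (j + 1) m r' l d c' → (c ≠ .S → c' = c) → l ≠ d ∧
        ((γ'.Offers l j m p d .S ∧ γ'.choice p (j + 1) = some l) ∨
          (c' ≠ .S ∧ γ'.Offers l j m p d c')) := by
    intro m r l d c hc r' c' hc' hcc
    obtain ⟨hld, ⟨ho, hq⟩ | ⟨hne, ho⟩⟩ := h m r l d c hc
    · refine ⟨hld, ?_⟩
      rcases hs.offers_S hD hld ho with ho' | ⟨k, hk, ⟨r'', hr⟩, ho'⟩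
      · exact .inl ⟨ho', hch ho' hld hq⟩
      · have : k = c := by
          rw [hc] at hr; simp only [Option.some.injEq, Msg.mk.injEq] at hr; exact hr.2.2.2.2.symm
        subst this
        rw [hcc hk]
        exact .inr ⟨hk, ho'⟩
    · rw [hcc hne]
      exact ⟨hld, .inr ⟨hne, hs.offers_ne_S hD hld hne ho ⟨r, hc⟩⟩⟩
  rcases hb : γ.buf p (j + 1) with _ | ⟨m, r, l, d, c⟩
  · rcases hs.of_none hb with h' | ⟨m, l, d, hm, -, hq⟩
    · exact Config.good_of_none h'
    · intro m' r' l' d' c' h'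
      rw [Config.Holds, hm] at h'
      simp only [Option.some.injEq, Msg.mk.injEq] at h'
      obtain ⟨rfl, rfl, rfl, rfl, rfl⟩ := h'
      obtain ⟨hq, ho⟩ := hq (by omega)
      have hld := ((hv.candidate_of_choice (by omega) (by omega) hq).ne_of_offers ho).2
      refine ⟨hld, .inl ?_⟩
      rcases hs.offers_S hD hld ho with ho' | ⟨c, -, ⟨r, hr⟩, -⟩
      · exact ⟨ho', hch ho' hld hq⟩
      · simp [hb] at hr
  · intro m' r' l' d' c' h'
    -- At ranks at least 2 an occupied buffer is either emptied or at most changes its type, and the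
    -- latter only from `S`.
    have key : ∃ r₁ c₁, γ'.buf p (j + 1) = some ⟨m, r₁, l, d, c₁⟩ ∧ (c ≠ .S → c₁ = c) := by
      by_cases hc : c = .S
      · subst hc
        rcases hs.of_S hb with h | ⟨c, -, h, -⟩
        · exact ⟨r, _, h, fun h => absurd rfl h⟩
        · exact ⟨r, _, h, fun h => absurd rfl h⟩
      · rcases hs.of_ne_S hb hc with h | ⟨-, h | h⟩
        · exact ⟨r, _, h, fun _ => rfl⟩
        · rw [Config.Holds, h.1] at h'
          cases h'
        · omega
    obtain ⟨r₁, c₁, h₁, hcc⟩ := key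
    rw [Config.Holds, h₁] at h'
    simp only [Option.some.injEq, Msg.mk.injEq] at h'
    obtain ⟨rfl, rfl, rfl, rfl, rfl⟩ := h'
    exact hup hb h₁ hcc

end Step

/-! ### Erasing answered copies. -/

namespace Config

/-- The next processor `r` does not hold a copy with the same type `c`. -/
def Free (γ : Config A M) (p : Fin n) (i : ℕ) (m : M) (r d : Fin n) (c : Kind) : Prop :=
  i ≤ G.diam → ¬ γ.Received r (i + 1) m p d c

variable {p : Fin n} {j : ℕ} {m : M} {r l d : Fin n} {c : Kind}

/-- Here and in the next two lemmas the rule is chosen before the configuration: weak fairness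
applies to one fixed action that stays enabled. The top rank and, here, the destination have rules
of their own. -/
theorem exists_fires_of_offers_same (h1 : 1 ≤ j) (hD : j ≤ G.diam) (hc : c ≠ .S) :
    ∃ k, ∀ γ : Config A M, γ.Holds p (j + 1) m r l d c → γ.Free p (j + 1) m r d c →
      γ.Offers l j m p d c → ∃ b, γ.Fires p k (j + 1) b := by
  have hc' := Kind.ne_S.1 hc
  by_cases hpd : p = d
  · subst hpd
    exact ⟨.R11, fun γ h _ ⟨q, ho⟩ => ⟨_, .r11 _ m r l q c (by omega) (by omega) h hc' ho⟩⟩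
  · rcases Nat.lt_or_eq_of_le hD with hlt | rfl
    · exact ⟨.R9, fun γ h hf ⟨q, ho⟩ => ⟨_, .r9 _ m r l d q c (by omega) (by omega) h hc'
        (Ne.symm hpd) ho fun r' hr => hf (by omega) ⟨r', hr⟩⟩⟩
    · exact ⟨.R14, fun γ h _ ⟨q, ho⟩ => ⟨_, .r14 m r l d q c h hc' (Ne.symm hpd) ho⟩⟩

theorem exists_fires_of_not_offers (h1 : 1 ≤ j) (hD : j ≤ G.diam) (hc : c ≠ .S) :
    ∃ k, ∀ γ : Config A M, γ.Holds p (j + 1) m r l d c → γ.Free p (j + 1) m r d c →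
      (∀ c', ¬ γ.Offers l j m p d c') → ∃ b, γ.Fires p k (j + 1) b := by
  have hc' := Kind.ne_S.1 hc
  rcases Nat.lt_or_eq_of_le hD with hlt | rfl
  · exact ⟨.R15, fun γ h hf ho => ⟨_, .r15 _ m r l d c (by omega) (by omega) h hc'
      (fun r' hr => hf (by omega) ⟨r', hr⟩) fun q c' hq => ho c' ⟨q, hq⟩⟩⟩
  · exact ⟨.R17, fun γ h _ ho => ⟨_, .r17 m r l d c h hc' fun q c' hq => ho c' ⟨q, hq⟩⟩⟩

theorem exists_fires_of_offers_other (h1 : 1 ≤ j) (hD : j ≤ G.diam) (hc : c ≠ .S) :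
    ∃ k, ∀ γ : Config A M, γ.Holds p (j + 1) m r l d c → γ.Free p (j + 1) m r d c →
      (∃ c', γ.Offers l j m p d c' ∧ (c' ≠ .S ∧ c' ≠ c ∨ l = d)) →
      ∃ b, γ.Fires p k (j + 1) b := by
  have hc' := Kind.ne_S.1 hc
  rcases Nat.lt_or_eq_of_le hD with hlt | rfl
  · exact ⟨.R16, fun γ h hf ⟨c', ⟨q, ho⟩, hcc⟩ => ⟨_, .r16 _ m r l d q c c' (by omega) (by omega) h
      hc' (fun r' hr => hf (by omega) ⟨r', hr⟩) ho (by rwa [Kind.ne_S] at hcc)⟩⟩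
  · exact ⟨.R18, fun γ h hf ⟨c', ⟨q, ho⟩, hcc⟩ => ⟨_, .r18 m r l d q c c' h hc' ho
      (by rwa [Kind.ne_S] at hcc)⟩⟩

end Config

namespace Step

variable {γ γ' : Config A M} {sel : Fin n → Option (Action A)}
  {p : Fin n} {j : ℕ} {m : M} {r l d : Fin n} {c : Kind}

/-- New copies have type `S`. A copy of type `S` at `r` that turned into `c` would, by goodness,
still be offered by `p` with type `S`, whereas `p` holds `c`. -/
theorem free (hs : Step γ sel γ') (hj : 1 ≤ j) (hg : j ≤ G.diam → γ.Good r j)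
    (h : γ.Holds p j m r l d c) (hc : c ≠ .S) (hf : γ.Free p j m r d c) :
    γ'.Free p j m r d c := by
  rintro hD ⟨q, hq⟩
  apply hf hD
  rcases hb : γ.buf r (j + 1) with _ | ⟨m₁, r₁, l₁, d₁, c₁⟩
  · rcases hs.of_none hb with h' | ⟨m', l', d', hm, -, ho⟩
    · rw [h'] at hq; cases hq
    · rw [Config.Holds, hq] at hm
      simp only [Option.some.injEq, Msg.mk.injEq] at hm
      exact absurd hm.2.2.2.2 hc
  · by_cases hc₁ : c₁ = .S
    · subst hc₁
      have key : m₁ = m ∧ l₁ = p ∧ d₁ = d := by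
        rcases hs.of_S hb with h' | ⟨c', -, h', -⟩ <;>
        · rw [Config.Holds, hq] at h'
          simp only [Option.some.injEq, Msg.mk.injEq] at h'
          grind
      obtain ⟨rfl, rfl, rfl⟩ := key
      obtain ⟨-, ⟨⟨x, ho⟩, -⟩ | ⟨h', -⟩⟩ := hg hD _ _ _ _ _ hb
      · rw [h] at ho
        simp only [Option.some.injEq, Msg.mk.injEq] at ho
        exact absurd ho.2.2.2.2 hc
      · exact absurd rfl h'
    · rcases hs.of_ne_S hb hc₁ with h' | ⟨-, h' | h'⟩
      · rw [Config.Holds, hq] at h'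
        simp only [Option.some.injEq, Msg.mk.injEq] at h'
        obtain ⟨rfl, rfl, rfl, rfl, rfl⟩ := h'
        exact ⟨_, hb⟩
      · rw [h'.1] at hq; cases hq
      · omega

/-- `R1` and `R8` refuse to create a message at `l` whose copy from `l` already sits in the next
buffer. Only a retry by `R2` can redirect the message to `p`, with type `S`; at the destination `R6`
keeps the next processor. -/
theorem not_offers (hs : Step γ sel γ') (hD : j ≤ G.diam)
    (h : γ.Holds p (j + 1) m r l d c) (ho : ∀ c', ¬ γ.Offers l j m p d c') :
    (∀ c', ¬ γ'.Offers l j m p d c') ∨ (l ≠ d ∧ γ'.Offers l j m p d .S) := by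
  by_contra hcon
  push Not at hcon
  obtain ⟨⟨c', q, hq⟩, hno⟩ := hcon
  rcases hb : γ.buf l j with _ | ⟨m₁, r₁, l₁, d₁, c₁⟩
  · rcases hs.of_none hb with h' | ⟨m', l', d', hm, hr, -⟩
    · rw [h'] at hq; cases hq
    · rw [Config.Holds, hq] at hm
      simp only [Option.some.injEq, Msg.mk.injEq] at hm
      obtain ⟨rfl, rfl, rfl, rfl, rfl⟩ := hm
      exact hr hD c ⟨r, h⟩
  · by_cases hc₁ : c₁ = .S
    · subst hc₁
      rcases hs.of_S hb with h' | ⟨c', -, h', -⟩ <;>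
      · rw [Config.Holds, hq] at h'
        simp only [Option.some.injEq, Msg.mk.injEq] at h'
        obtain ⟨rfl, rfl, rfl, rfl, rfl⟩ := h'
        exact ho _ ⟨_, hb⟩
    · rcases hs.of_ne_S hb hc₁ with h' | ⟨-, h' | ⟨-, -, r', h', hor⟩⟩
      · rw [Config.Holds, hq] at h'
        simp only [Option.some.injEq, Msg.mk.injEq] at h'
        obtain ⟨rfl, rfl, rfl, rfl, rfl⟩ := h'
        exact ho _ ⟨_, hb⟩
      · rw [h'.1] at hq; cases hq
      · rw [Config.Holds, hq] at h'
        simp only [Option.some.injEq, Msg.mk.injEq] at h'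
        obtain ⟨rfl, rfl, rfl, rfl, rfl⟩ := h'
        by_cases hld : l = d
        · obtain ⟨-, rfl⟩ : l = d ∧ p = r₁ := by tauto
          exact ho _ ⟨_, hb⟩
        · exact hno hld ⟨_, hq⟩

end Step

namespace Execution

variable (e : Execution A M)

/-- All buffers of the ranks `j + 1, …, D + 1` are good. -/
def GoodFrom (j t : ℕ) : Prop := ∀ i, j ≤ i → i ≤ G.diam → ∀ p, (e.conf t).Good p i

variable {e}

theorem GoodFrom.of_le {j s t : ℕ} (h : e.GoodFrom j s) (hj : 1 ≤ j) (hst : s ≤ t) :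
    e.GoodFrom j t := by
  induction t, hst using Nat.le_induction with
  | base => exact h
  | succ t _ ih =>
    exact fun i hi hD p => (e.step t).good (e.valid t) (e.valid _) (by omega) hD (ih i hi hD p)

variable (e) in
/-- No action of the routing algorithm is ever enabled. -/
def Silent : Prop := ∀ t, A.Terminal (e.conf t).rt

variable (hT : e.Silent)
include hT

theorem ensures_rule {t : ℕ} {I Q : ℕ → Prop} (p : Fin n) (k : Rule) (i : ℕ) (hI : I t)
    (hen : ∀ v, t ≤ v → I v → ∃ b, (e.conf v).Fires p k i b)
    (hex : ∀ v, t ≤ v → I v → (e.conf v).Fires p k i ((e.conf (v + 1)).buf p i) → Q (v + 1))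
    (hstep : ∀ v, t ≤ v → I v → I (v + 1) ∨ Q (v + 1)) : Reaches e.en e.sel 1 t Q :=
  Reaches.ensures e.finitelyFair p (.inr (k, i)) hI
    (fun v hv h => ⟨hen v hv h, hT v p⟩)
    (fun v hv h hs => hex v hv h ((e.step v).fires_of_sel hs)) hstep

end Execution

namespace Execution

variable {e : Execution A M} (hT : e.Silent)
include hT

/-- The answered copy cannot vanish before `R7` acts: each rule that erases it requires that its
sender no longer offers the message with type `S`, or that the sender is the destination. -/
theorem ensures_R7 {t j : ℕ} {p r l d r' : Fin n} {m : M} {c : Kind} (h1 : 1 ≤ j)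
    (hD : j ≤ G.diam) (hc : c ≠ .S) (hpd : p ≠ d) (h : (e.conf t).Holds p j m r l d .S)
    (hr : (e.conf t).Holds r (j + 1) m r' p d c) :
    Reaches e.en e.sel 1 t fun u =>
      (e.conf u).Holds p j m r l d c ∧ (e.conf u).Holds r (j + 1) m r' p d c := by
  have hdown : ∀ v, (e.conf v).Holds p j m r l d .S → (e.conf v).Holds r (j + 1) m r' p d c →
      (e.conf (v + 1)).Holds r (j + 1) m r' p d c := by
    intro v hS hr
    rcases (e.step v).of_ne_S hr hc with h' | ⟨-, ⟨-, h', -⟩ | h'⟩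
    · exact h'
    · exact absurd ⟨l, hS⟩ (h' (by omega) hpd)
    · omega
  refine ensures_rule hT p .R7 j
    (I := fun v => (e.conf v).Holds p j m r l d .S ∧ (e.conf v).Holds r (j + 1) m r' p d c)
    ⟨h, hr⟩ ?_ ?_ ?_
  · rintro v - ⟨hS, hr⟩
    exact ⟨_, .r7 j m r l d r' c h1 hD hS hpd hr (Kind.ne_S.1 hc)⟩
  · rintro v - ⟨hS, hr⟩ hfire
    obtain ⟨c', -, hb, h' | h' | ⟨-, -, q, hq⟩⟩ := hfire.of_S hS
    · exact absurd h'.1 hpd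
    · omega
    · obtain ⟨-, -, -, -, rfl⟩ := hr.inj hq
      exact ⟨hb, hdown v hS hr⟩
  · rintro v - ⟨hS, hr⟩
    rcases (e.step v).of_S hS with hS' | ⟨c', -, hb, h' | h' | ⟨-, -, q, hq⟩⟩
    · exact .inl ⟨hS', hdown v hS hr⟩
    · exact absurd h'.1 hpd
    · omega
    · obtain ⟨-, -, -, -, rfl⟩ := hr.inj hq
      exact .inr ⟨hb, hdown v hS hr⟩

section Clear

variable {t j : ℕ} {p r l d : Fin n} {m : M} {c : Kind}

omit hT in
theorem holds_free_step {v : ℕ} (h1 : 1 ≤ j) (hc : c ≠ .S) (hg : e.GoodFrom (j + 1) v)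
    (h : (e.conf v).Holds p (j + 1) m r l d c ∧ (e.conf v).Free p (j + 1) m r d c) :
    ((e.conf (v + 1)).Holds p (j + 1) m r l d c ∧ (e.conf (v + 1)).Free p (j + 1) m r d c) ∨
      (e.conf (v + 1)).buf p (j + 1) = none := by
  rcases (e.step v).of_ne_S h.1 hc with h' | ⟨-, ⟨h', -⟩ | h'⟩
  · exact .inl ⟨h', (e.step v).free (by omega) (fun hD => hg _ (by omega) hD r) h.1 hc h.2⟩
  · exact .inr h'
  · omega

/-- A rule that is enabled as long as the upstream buffer satisfies `U` empties the buffer, unless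
`U` ceases to hold. -/
theorem reaches_none_or (h1 : 1 ≤ j) (hc : c ≠ .S) (hg : e.GoodFrom (j + 1) t)
    (h : (e.conf t).Holds p (j + 1) m r l d c) (hf : (e.conf t).Free p (j + 1) m r d c)
    {U V : Config A M → Prop} (hU : U (e.conf t)) {k : Rule}
    (hen : ∀ γ : Config A M, γ.Holds p (j + 1) m r l d c → γ.Free p (j + 1) m r d c → U γ →
      ∃ b, γ.Fires p k (j + 1) b)
    (hUV : ∀ v, (e.conf v).Holds p (j + 1) m r l d c → U (e.conf v) →
      (e.conf (v + 1)).Holds p (j + 1) m r l d c →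
      U (e.conf (v + 1)) ∨ V (e.conf (v + 1))) :
    Reaches e.en e.sel 1 t fun u => (e.conf u).buf p (j + 1) = none ∨
      ((e.conf u).Holds p (j + 1) m r l d c ∧ (e.conf u).Free p (j + 1) m r d c) ∧
        V (e.conf u) := by
  refine ensures_rule hT p k (j + 1)
    (I := fun v => ((e.conf v).Holds p (j + 1) m r l d c ∧ (e.conf v).Free p (j + 1) m r d c) ∧
      U (e.conf v)) ⟨⟨h, hf⟩, hU⟩ ?_ ?_ ?_
  · rintro v - ⟨⟨h, hf⟩, hU⟩
    exact hen _ h hf hU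
  · rintro v - ⟨⟨h, hf⟩, hU⟩ hfire
    obtain ⟨-, ⟨hb, -⟩ | h'⟩ := hfire.of_ne_S h hc
    · exact .inl hb
    · omega
  · rintro v hv ⟨hh, hU⟩
    rcases holds_free_step h1 hc (hg.of_le (by omega) hv) hh with h' | h'
    · rcases hUV v hh.1 hU h'.1 with hU' | hV
      · exact .inl ⟨h', hU'⟩
      · exact .inr (.inr ⟨h', hV⟩)
    · exact .inr (.inl h')

theorem reaches_none_of_offers_same (h1 : 1 ≤ j) (hD : j ≤ G.diam) (hc : c ≠ .S)
    (hg : e.GoodFrom (j + 1) t)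
    (h : (e.conf t).Holds p (j + 1) m r l d c) (hf : (e.conf t).Free p (j + 1) m r d c)
    (hld : l ≠ d) (ho : (e.conf t).Offers l j m p d c) :
    Reaches e.en e.sel 1 t fun u => (e.conf u).buf p (j + 1) = none := by
  obtain ⟨k, hk⟩ := Config.exists_fires_of_offers_same (A := A) (p := p) (m := m) (r := r) (l := l)
    (d := d) h1 hD hc
  refine (reaches_none_or hT h1 hc hg h hf (U := fun γ => γ.Offers l j m p d c)
    (V := fun _ => False) ho hk ?_).mono_right ?_
  · exact fun v h ho _ => .inl ((e.step v).offers_ne_S hD hld hc ho ⟨r, h⟩)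
  · tauto

theorem reaches_none_of_offers_S (h1 : 1 ≤ j) (hD : j ≤ G.diam) (hc : c ≠ .S)
    (hg : e.GoodFrom (j + 1) t)
    (h : (e.conf t).Holds p (j + 1) m r l d c) (hf : (e.conf t).Free p (j + 1) m r d c)
    (hld : l ≠ d) (ho : (e.conf t).Offers l j m p d .S) :
    Reaches e.en e.sel 2 t fun u => (e.conf u).buf p (j + 1) = none := by
  obtain ⟨q, hq⟩ := ho
  have hI := (ensures_R7 hT h1 hD hc hld hq h).stays_or (I := fun v =>
    (e.conf v).Holds p (j + 1) m r l d c ∧ (e.conf v).Free p (j + 1) m r d c)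
    (J := fun v => (e.conf v).buf p (j + 1) = none) ⟨h, hf⟩
    fun v hv hI => holds_free_step h1 hc (hg.of_le (by omega) hv) hI
  refine hI.trans e.finitelyFair (l := 1) ?_
  rintro u hu (⟨⟨hq, -⟩, h, hf⟩ | hn)
  · exact reaches_none_of_offers_same hT h1 hD hc (hg.of_le (by omega) hu) h hf hld ⟨q, hq⟩
  · exact (Reaches.refl hn).mono e.finitelyFair (by omega)

theorem reaches_none_of_not_offers (h1 : 1 ≤ j) (hD : j ≤ G.diam) (hc : c ≠ .S)
    (hg : e.GoodFrom (j + 1) t)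
    (h : (e.conf t).Holds p (j + 1) m r l d c) (hf : (e.conf t).Free p (j + 1) m r d c)
    (ho : ∀ c', ¬ (e.conf t).Offers l j m p d c') :
    Reaches e.en e.sel 3 t fun u => (e.conf u).buf p (j + 1) = none := by
  obtain ⟨k, hk⟩ := Config.exists_fires_of_not_offers (A := A) (p := p) (m := m) (r := r) (l := l)
    (d := d) h1 hD hc
  refine (reaches_none_or hT h1 hc hg h hf (U := fun γ => ∀ c', ¬ γ.Offers l j m p d c')
    (V := fun γ => l ≠ d ∧ γ.Offers l j m p d .S) ho hk ?_).trans e.finitelyFair (l := 2) ?_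
  · exact fun v h ho _ => (e.step v).not_offers hD h ho
  · rintro u hu (hn | ⟨⟨h, hf⟩, hld, ho⟩)
    · exact (Reaches.refl hn).mono e.finitelyFair (by omega)
    · exact reaches_none_of_offers_S hT h1 hD hc (hg.of_le (by omega) hu) h hf hld ho

/-- The upstream situations form a chain without return: a conflicting type (or `l = d`), no offer,
an offer of type `S`, the same type `c`. In each of them the copy is erased or the situation
advances; one round is spent per link, whence 4. -/
theorem reaches_none_of_free (h1 : 1 ≤ j) (hD : j ≤ G.diam) (hc : c ≠ .S)
    (hg : e.GoodFrom (j + 1) t)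
    (h : (e.conf t).Holds p (j + 1) m r l d c) (hf : (e.conf t).Free p (j + 1) m r d c) :
    Reaches e.en e.sel 4 t fun u => (e.conf u).buf p (j + 1) = none := by
  obtain ⟨k, hk⟩ := Config.exists_fires_of_offers_other (A := A) (p := p) (m := m) (r := r) (l := l)
    (d := d) h1 hD hc
  have aux : ∀ u, t ≤ u → (e.conf u).Holds p (j + 1) m r l d c →
      (e.conf u).Free p (j + 1) m r d c →
      ¬ (∃ c', (e.conf u).Offers l j m p d c' ∧ (c' ≠ .S ∧ c' ≠ c ∨ l = d)) →
      Reaches e.en e.sel 3 u fun u => (e.conf u).buf p (j + 1) = none := by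
    intro u hu h hf hU
    have hg' := hg.of_le (by omega) hu
    by_cases ho : ∀ c', ¬ (e.conf u).Offers l j m p d c'
    · exact reaches_none_of_not_offers hT h1 hD hc hg' h hf ho
    · push Not at ho hU
      obtain ⟨c', ho⟩ := ho
      obtain ⟨h3, hld⟩ := hU c' ho
      by_cases hcS : c' = .S
      · subst hcS
        exact (reaches_none_of_offers_S hT h1 hD hc hg' h hf hld ho).mono e.finitelyFair (by omega)
      · obtain rfl := h3 hcS
        exact (reaches_none_of_offers_same hT h1 hD hc hg' h hf hld ho).mono e.finitelyFair
          (by omega)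
  by_cases hU : ∃ c', (e.conf t).Offers l j m p d c' ∧ (c' ≠ .S ∧ c' ≠ c ∨ l = d)
  · refine (reaches_none_or hT h1 hc hg h hf
      (U := fun γ => ∃ c', γ.Offers l j m p d c' ∧ (c' ≠ .S ∧ c' ≠ c ∨ l = d))
      (V := fun γ => ¬ ∃ c', γ.Offers l j m p d c' ∧ (c' ≠ .S ∧ c' ≠ c ∨ l = d)) hU hk
      fun v _ _ _ => em _).trans e.finitelyFair (l := 3) ?_
    rintro u hu (hn | ⟨⟨h, hf⟩, hV⟩)
    · exact (Reaches.refl hn).mono e.finitelyFair (by omega)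
    · exact aux u hu h hf hV
  · exact (aux t le_rfl h hf hU).mono e.finitelyFair (by omega)

end Clear

/-- Acknowledged and failed copies are erased in a number of rounds that is linear in the number of
higher ranks. -/
theorem reaches_none_of_ne_S (k : ℕ) : ∀ {t j : ℕ} {p r l d : Fin n} {m : M} {c : Kind},
    j + k = G.diam → 1 ≤ j → c ≠ .S → e.GoodFrom (j + 1) t →
    (e.conf t).Holds p (j + 1) m r l d c →
    Reaches e.en e.sel (4 * (k + 1)) t fun u => (e.conf u).buf p (j + 1) = none := by
  induction k with
  | zero =>
    intro t j p r l d m c hj h1 hc hg h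
    exact reaches_none_of_free hT h1 (by omega) hc hg h fun hD => by omega
  | succ k ih =>
    intro t j p r l d m c hj h1 hc hg h
    by_cases hf : (e.conf t).Free p (j + 1) m r d c
    · exact (reaches_none_of_free hT h1 (by omega) hc hg h hf).mono e.finitelyFair (by omega)
    -- The obstacle is a copy of the same type one rank higher. It is erased by induction, and then
    -- the buffer is free.
    · unfold Config.Free at hf
      push Not at hf
      obtain ⟨hD, r', hr⟩ := hf
      have h2 := (ih (by omega) (by omega) hc (fun i hi => hg i (by omega)) hr).stays_or
        (I := fun v => (e.conf v).Holds p (j + 1) m r l d c)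
        (J := fun v => (e.conf v).buf p (j + 1) = none) h (by
          intro v _ hI
          rcases (e.step v).of_ne_S hI hc with h' | ⟨-, ⟨h', -⟩ | h'⟩
          · exact .inl h'
          · exact .inr h'
          · omega)
      refine (h2.trans e.finitelyFair (l := 4) ?_).mono e.finitelyFair (by omega)
      rintro u hu (⟨hn, h⟩ | hn)
      · refine reaches_none_of_free hT h1 (by omega) hc (hg.of_le (by omega) hu) h ?_
        rintro - ⟨q, hq⟩
        rw [hn] at hq
        cases hq
      · exact (Reaches.refl hn).mono e.finitelyFair (by omega)

end Execution

/-! ### Queues: nobody overtakes a waiting candidate. -/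

theorem takeWhile_filter_subset {α : Type*} [DecidableEq α] (p : α) (P : α → Bool) (hP : P p = true)
    (l : List α) : (l.filter P).takeWhile (· ≠ p) ⊆ l.takeWhile (· ≠ p) := by
  induction l with
  | nil => simp
  | cons a l ih =>
    by_cases hap : a = p
    · subst hap
      simp [hP]
    · by_cases ha : P a = true
      · rw [List.filter_cons_of_pos ha, List.takeWhile_cons_of_pos (by simpa using hap),
          List.takeWhile_cons_of_pos (by simpa using hap)]
        exact List.cons_subset_cons _ ih
      · rw [List.filter_cons_of_neg ha, List.takeWhile_cons_of_pos (by simpa using hap)]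
        exact List.Subset.trans ih (List.subset_cons_self _ _)

namespace Config

/-- The processors that precede `p` in the queue of the buffer of rank `i` of `r`. -/
def ahead (γ : Config A M) (r : Fin n) (i : ℕ) (p : Fin n) : Finset (Fin n) :=
  ((γ.queue r i).takeWhile (· ≠ p)).toFinset

variable {γ γ' : Config A M} {r p s : Fin n} {i : ℕ}

theorem ne_of_mem_ahead (h : s ∈ γ.ahead r i p) : s ≠ p := by
  unfold ahead at h
  rw [List.mem_toFinset] at h
  simpa using List.mem_takeWhile_imp h

theorem Valid.candidate_of_mem_ahead (hv : γ.Valid) (h2 : 2 ≤ i) (hD : i ≤ G.diam + 1)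
    (h : s ∈ γ.ahead r i p) : γ.Candidate r i s := by
  unfold ahead at h
  rw [List.mem_toFinset] at h
  exact (hv.mem_queue r i s h2 hD).1 ((List.takeWhile_prefix _).subset h)

theorem Valid.exists_choice (hv : γ.Valid) (h2 : 2 ≤ i) (hD : i ≤ G.diam + 1)
    (hp : γ.Candidate r i p) :
    ∃ s, γ.choice r i = some s ∧ (s = p ∨ s ∈ γ.ahead r i p) := by
  have hmem := (hv.mem_queue r i p h2 hD).2 hp
  unfold choice ahead
  rcases hq : γ.queue r i with _ | ⟨s, q⟩
  · rw [hq] at hmem; cases hmem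
  · refine ⟨s, rfl, ?_⟩
    by_cases hsp : s = p
    · exact .inl hsp
    · right
      rw [List.takeWhile_cons_of_pos (by simpa using hsp)]
      simp

end Config

/-- While `p` remains a candidate, departures can only shrink the part of the queue before `p`, and
newcomers are appended behind it. -/
theorem Step.ahead_subset {γ γ' : Config A M} {sel : Fin n → Option (Action A)} {r p : Fin n} {i : ℕ}
    (hs : Step γ sel γ') (hv : γ.Valid) (h2 : 2 ≤ i) (hD : i ≤ G.diam + 1)
    (hp : γ.Candidate r i p) (hp' : γ'.Candidate r i p) :
    γ'.ahead r i p ⊆ γ.ahead r i p := by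
  classical
  have hmem := (hv.mem_queue r i p h2 hD).2 hp
  obtain ⟨x, hx⟩ := hs.queue_fifo r i h2 hD
  intro s hs
  unfold Config.ahead at hs ⊢
  rw [List.mem_toFinset] at hs ⊢
  rw [← hx] at hs
  refine takeWhile_filter_subset p (fun s => decide (γ'.Candidate r i s)) (by simpa using hp') _ ?_
  have hpf : p ∈ (γ.queue r i).filter (fun s => decide (γ'.Candidate r i s)) := by
    simp [hmem, hp']
  generalize (γ.queue r i).filter (fun s => decide (γ'.Candidate r i s)) = f at hs hpf ⊢
  rw [List.takeWhile_append] at hs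
  split_ifs at hs with hlen
  · have := (List.takeWhile_prefix (l := f) (· ≠ p)).eq_of_length hlen
    rw [← this] at hpf
    simpa using List.mem_takeWhile_imp hpf
  · exact hs

/-! ### Answering times, by descending induction on the rank. -/

/-- Bound on the number of rounds before the buffer of rank `D + 1 - k` gets an answer. -/
def relayBound (Δ : ℕ) : ℕ → ℕ
  | 0 => 1
  | k + 1 => (Δ - 1) * (relayBound Δ k + 4 * (k + 1) + 1) + relayBound Δ k + 2

theorem one_le_relayBound (Δ k : ℕ) : 1 ≤ relayBound Δ k := by
  cases k <;> simp [relayBound]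

namespace Execution

variable {e : Execution A M}

/-- A message offered by a buffer of rank `i` gets an answer within `w` rounds, if all buffers of
higher ranks are good. -/
def Relays (e : Execution A M) (i w : ℕ) : Prop :=
  ∀ (t : ℕ) (p r l d : Fin n) (m : M), e.GoodFrom i t → (e.conf t).Holds p i m r l d .S →
    Reaches e.en e.sel w t fun u => ∃ c, c ≠ .S ∧ (e.conf u).Holds p i m r l d c

/-- A buffer of rank `i` is emptied within `x` rounds, if all buffers of higher ranks are good. -/
def Empties (e : Execution A M) (i x : ℕ) : Prop :=
  ∀ (t : ℕ) (p : Fin n), e.GoodFrom i t →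
    Reaches e.en e.sel x t fun u => (e.conf u).buf p i = none

theorem Relays.empties (hT : e.Silent) {j k w : ℕ} (hj : 1 ≤ j) (hk : j + k = G.diam)
    (h : e.Relays (j + 1) w) : e.Empties (j + 1) (w + 4 * (k + 1)) := by
  intro t p hg
  rcases hb : (e.conf t).buf p (j + 1) with _ | ⟨m, r, l, d, c⟩
  · exact (Reaches.refl hb).mono e.finitelyFair (by omega)
  · by_cases hc : c = .S
    · subst hc
      refine (h _ _ _ _ _ _ hg hb).trans e.finitelyFair ?_
      rintro u hu ⟨c, hc, hb⟩
      exact reaches_none_of_ne_S hT k hk hj hc (hg.of_le (by omega) hu) hb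
    · exact (reaches_none_of_ne_S hT k hk hj hc hg hb).mono e.finitelyFair (by omega)

section

variable (hT : e.Silent) {t j w : ℕ} {p r l d : Fin n} {m : M}
include hT

/-- The destination delivers a message within one round. -/
theorem reaches_delivered {i : ℕ} (h1 : 1 ≤ i) (hD : i ≤ G.diam + 1)
    (h : (e.conf t).Holds p i m r l p .S) :
    Reaches e.en e.sel 1 t fun u => (e.conf u).Holds p i m r l p .A := by
  obtain ⟨k, hk⟩ : ∃ k, ∀ γ : Config A M, γ.Holds p i m r l p .S → ∃ b, γ.Fires p k i b := by
    rcases Nat.eq_or_lt_of_le h1 with rfl | h2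
    · exact ⟨.R4, fun γ h => ⟨_, .r4 m r l h⟩⟩
    · exact ⟨.R10, fun γ h => ⟨_, .r10 i m r l h2 hD h⟩⟩
  refine ensures_rule hT p k i (I := fun v => (e.conf v).Holds p i m r l p .S) h
    (fun v _ => hk _) ?_ ?_
  · rintro v - h hf
    obtain ⟨c, -, hb, h' | h' | h'⟩ := hf.of_S h
    · exact h'.2 ▸ hb
    · exact absurd rfl h'.1
    · exact absurd rfl h'.1
  · rintro v - h
    rcases (e.step v).of_S h with h | ⟨c, -, hb, h' | h' | h'⟩
    · exact .inl h
    · exact .inr (h'.2 ▸ hb)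
    · exact absurd rfl h'.1
    · exact absurd rfl h'.1

theorem relays_top : e.Relays (G.diam + 1) 1 := by
  intro t p r l d m _ h
  by_cases hpd : p = d
  · subst hpd
    exact (reaches_delivered hT (by omega) le_rfl h).mono_right fun u hu => ⟨_, by simp, hu⟩
  · refine ensures_rule hT p .R13 _
      (I := fun v => (e.conf v).Holds p (G.diam + 1) m r l d .S) h
      (fun v _ h => ⟨_, .r13 m r l d h (Ne.symm hpd)⟩) ?_ ?_
    · rintro v - h hf
      obtain ⟨c, hc, hb, -⟩ := hf.of_S h
      exact ⟨c, hc, hb⟩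
    · rintro v - h
      rcases (e.step v).of_S h with h | ⟨c, hc, hb, -⟩
      · exact .inl h
      · exact .inr ⟨c, hc, hb⟩

omit hT in
theorem answered_or_step {v : ℕ} (h : (e.conf v).Holds p j m r l d .S) :
    (e.conf (v + 1)).Holds p j m r l d .S ∨
      ∃ c, c ≠ .S ∧ (e.conf (v + 1)).Holds p j m r l d c := by
  rcases (e.step v).of_S h with h | ⟨c, hc, hb, -⟩
  · exact .inl h
  · exact .inr ⟨c, hc, hb⟩

theorem reaches_answer_of_received (hw : e.Relays (j + 1) w) (hj : 1 ≤ j) (hD : j ≤ G.diam)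
    (hpd : p ≠ d) (hg : e.GoodFrom j t) (h : (e.conf t).Holds p j m r l d .S) {c : Kind}
    (hr : (e.conf t).Received r (j + 1) m p d c) :
    Reaches e.en e.sel (w + 1) t fun u => ∃ c, c ≠ .S ∧ (e.conf u).Holds p j m r l d c := by
  obtain ⟨q, hq⟩ := hr
  have hR7 : ∀ u c, c ≠ .S → (e.conf u).Holds p j m r l d .S →
      (e.conf u).Holds r (j + 1) m q p d c →
      Reaches e.en e.sel 1 u fun u => ∃ c, c ≠ .S ∧ (e.conf u).Holds p j m r l d c := by
    intro u c hc h hq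
    exact (ensures_R7 hT hj hD hc hpd h hq).mono_right fun v hv => ⟨c, hc, hv.1⟩
  by_cases hc : c = .S
  · subst hc
    refine ((hw _ _ _ _ _ _ (fun i hi => hg i (by omega)) hq).stays_or
      (I := fun v => (e.conf v).Holds p j m r l d .S)
      (J := fun v => ∃ c, c ≠ .S ∧ (e.conf v).Holds p j m r l d c) h
      fun v _ => answered_or_step).trans e.finitelyFair ?_
    rintro u - (⟨⟨c, hc, hq⟩, h⟩ | h)
    · exact hR7 u c hc h hq
    · exact (Reaches.refl h).mono e.finitelyFair (by omega)
  · exact (hR7 t c hc h hq).mono e.finitelyFair (by omega)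

omit hT in
theorem candidate_of_holds {v : ℕ} (hpd : p ≠ d) (h : (e.conf v).Holds p j m r l d .S) :
    (e.conf v).Candidate r (j + 1) p :=
  Config.Offers.candidate ⟨l, h⟩ hpd (e.valid v)

omit hT in
theorem ahead_step {v : ℕ} (hj : 1 ≤ j) (hD : j ≤ G.diam) (hpd : p ≠ d)
    (h : (e.conf v).Holds p j m r l d .S) (h' : (e.conf (v + 1)).Holds p j m r l d .S) :
    (e.conf (v + 1)).ahead r (j + 1) p ⊆ (e.conf v).ahead r (j + 1) p :=
  (e.step v).ahead_subset (e.valid v) (by omega) (by omega) (candidate_of_holds hpd h)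
    (candidate_of_holds hpd h')

omit hT in
/-- When the buffer in front of `p` contains a message from `s ≠ p`, it is emptied, and then `s` does
not precede `p` in the queue. -/
theorem reaches_empty_ahead {x : ℕ} (hx : e.Empties (j + 1) x) (hj : 1 ≤ j) (hD : j ≤ G.diam)
    (hpd : p ≠ d) (hg : e.GoodFrom j t) (h : (e.conf t).Holds p j m r l d .S)
    {ms : M} {rs s ds : Fin n} {cs : Kind} (hs : (e.conf t).Holds r (j + 1) ms rs s ds cs) :
    Reaches e.en e.sel x t fun u => (∃ c, c ≠ .S ∧ (e.conf u).Holds p j m r l d c) ∨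
      ((e.conf u).Holds p j m r l d .S ∧ (e.conf u).buf r (j + 1) = none ∧
        (e.conf u).ahead r (j + 1) p ⊆ (e.conf t).ahead r (j + 1) p \ {s}) := by
  have h2 := (hx t r fun i hi => hg i (by omega)).stays_or
    (I := fun v => (e.conf v).Holds p j m r l d .S ∧
      (e.conf v).ahead r (j + 1) p ⊆ (e.conf t).ahead r (j + 1) p ∧
      ∃ c, (e.conf v).Holds r (j + 1) ms rs s ds c)
    (J := fun u => (∃ c, c ≠ .S ∧ (e.conf u).Holds p j m r l d c) ∨
      ((e.conf u).Holds p j m r l d .S ∧ (e.conf u).buf r (j + 1) = none ∧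
        (e.conf u).ahead r (j + 1) p ⊆ (e.conf t).ahead r (j + 1) p \ {s}))
    ⟨h, subset_rfl, cs, hs⟩ ?_
  · refine h2.mono_right ?_
    rintro u (⟨hn, -, -, c, hc⟩ | hJ)
    · rw [Config.Holds, hn] at hc; cases hc
    · exact hJ
  · rintro v hv ⟨h, hB, c, hc⟩
    rcases answered_or_step h with h' | h'
    · have hB' := (ahead_step hj hD hpd h h').trans hB
      by_cases hcS : c = .S
      · subst hcS
        rcases (e.step v).of_S hc with hc' | ⟨c', -, hc', -⟩
        · exact .inl ⟨h', hB', _, hc'⟩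
        · exact .inl ⟨h', hB', _, hc'⟩
      · rcases (e.step v).of_ne_S hc hcS with hc' | ⟨-, ⟨hn, hup, -⟩ | hh⟩
        · exact .inl ⟨h', hB', _, hc'⟩
        · refine .inr (.inr ⟨h', hn, fun y hy => ?_⟩)
          rw [Finset.mem_sdiff, Finset.mem_singleton]
          refine ⟨hB' hy, ?_⟩
          rintro rfl
          -- By goodness, when the copy is erased its sender `s` has already adopted the answer, so
          -- `s` no longer offers a message of type `S` and has left the queue.
          obtain ⟨hld, ⟨ho, -⟩ | ⟨-, ho⟩⟩ := (hg.of_le hj hv) j le_rfl hD r _ _ _ _ _ hc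
          · exact hup (by omega) hld ho
          · have ho' := (e.step v).offers_ne_S hD hld hcS ho ⟨_, hc⟩
            have hcand := (e.valid (v + 1)).candidate_of_mem_ahead (by omega) (by omega) hy
            exact hcS (hcand.ne_of_offers ho').1
        · omega
    · exact .inr (.inl h')

/-- An empty buffer in front of `p` is filled by the head of the queue. -/
theorem reaches_filled (hj : 1 ≤ j) (hD : j ≤ G.diam)
    (hpd : p ≠ d) (hg : e.GoodFrom j t) (h : (e.conf t).Holds p j m r l d .S)
    (hn : (e.conf t).buf r (j + 1) = none) :
    Reaches e.en e.sel 1 t fun u => (e.conf u).Holds p j m r l d .S ∧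
      (e.conf u).ahead r (j + 1) p ⊆ (e.conf t).ahead r (j + 1) p ∧
      ∃ ms rs s ds, (e.conf u).Holds r (j + 1) ms rs s ds .S ∧
        (s = p ∧ ms = m ∧ ds = d ∨ s ∈ (e.conf t).ahead r (j + 1) p) := by
  obtain ⟨k, hk⟩ : ∃ k, ∀ v, t ≤ v → (e.conf v).Holds p j m r l d .S →
      (e.conf v).buf r (j + 1) = none → ∃ b, (e.conf v).Fires r k (j + 1) b := by
    have aux : ∀ v, (e.conf v).Holds p j m r l d .S → ∃ s ms q ds,
        (e.conf v).choice r (j + 1) = some s ∧ (e.conf v).Holds s j ms r q ds .S := by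
      intro v h
      obtain ⟨s, hs, -⟩ := (e.valid v).exists_choice (by omega) (by omega)
        (candidate_of_holds hpd h)
      obtain ⟨-, ms, q, ds, ho, -⟩ := (e.valid v).candidate_of_choice (by omega) (by omega) hs
      exact ⟨s, ms, q, ds, hs, ho⟩
    rcases Nat.lt_or_eq_of_le hD with hlt | rfl
    · refine ⟨.R8, fun v hv h hn => ?_⟩
      obtain ⟨s, ms, q, ds, hs, ho⟩ := aux v h
      refine ⟨_, .r8 (j + 1) ms s q ds (by omega) hlt hn hs ho fun x c hx => ?_⟩
      -- The guard of `R8` forbids an older copy one rank higher; by goodness such a copy would have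
      -- its origin in the buffer of `r`, which is empty.
      obtain ⟨-, ⟨⟨y, hy⟩, -⟩ | ⟨-, y, hy⟩⟩ :=
        (hg.of_le hj hv) (j + 1) (by omega) hlt _ _ _ _ _ _ hx <;>
      · rw [hn] at hy; cases hy
    · refine ⟨.R12, fun v hv h hn => ?_⟩
      obtain ⟨s, ms, q, ds, hs, ho⟩ := aux v h
      exact ⟨_, .r12 ms s q ds hn hs ho⟩
  have hstep : ∀ v, (e.conf v).Holds p j m r l d .S → (e.conf v).buf r (j + 1) = none →
      (e.conf (v + 1)).Holds p j m r l d .S := by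
    intro v h hn
    rcases (e.step v).of_S h with h' | ⟨c, -, -, h' | h' | ⟨-, -, q, hq⟩⟩
    · exact h'
    · exact absurd h'.1 hpd
    · omega
    · rw [hn] at hq; cases hq
  have hfill : ∀ v, t ≤ v → (e.conf v).Holds p j m r l d .S →
      (e.conf v).ahead r (j + 1) p ⊆ (e.conf t).ahead r (j + 1) p → ∀ {ms rs s ds},
      (e.conf v).choice r (j + 1) = some s → (e.conf v).Offers s j ms r ds .S →
      (e.conf (v + 1)).Holds r (j + 1) ms rs s ds .S →
      ∃ ms rs s ds, (e.conf (v + 1)).Holds r (j + 1) ms rs s ds .S ∧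
        (s = p ∧ ms = m ∧ ds = d ∨ s ∈ (e.conf t).ahead r (j + 1) p) := by
    intro v hv h hB ms rs s ds hs ⟨q, ho⟩ hb
    refine ⟨ms, rs, s, ds, hb, ?_⟩
    obtain ⟨s', hs', hor⟩ := (e.valid v).exists_choice (by omega) (by omega)
      (candidate_of_holds hpd h)
    rw [hs] at hs'
    obtain rfl := Option.some.inj hs'
    rcases hor with rfl | hor
    · left
      obtain ⟨rfl, -, -, rfl, -⟩ := h.inj ho
      exact ⟨rfl, rfl, rfl⟩
    · exact .inr (hB hor)
  refine ensures_rule hT r k (j + 1) (I := fun v => (e.conf v).Holds p j m r l d .S ∧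
    (e.conf v).ahead r (j + 1) p ⊆ (e.conf t).ahead r (j + 1) p ∧
    (e.conf v).buf r (j + 1) = none) ⟨h, subset_rfl, hn⟩ ?_ ?_ ?_
  · rintro v hv ⟨h, -, hn⟩
    exact hk v hv h hn
  · rintro v hv ⟨h, hB, hn⟩ hf
    have h' := hstep v h hn
    obtain ⟨ms, s, ds, hb, -, hs⟩ := hf.of_none hn
    obtain ⟨hs, ho⟩ := hs (by omega)
    exact ⟨h', (ahead_step hj hD hpd h h').trans hB, hfill v hv h hB hs ho hb⟩
  · rintro v hv ⟨h, hB, hn⟩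
    have h' := hstep v h hn
    have hB' := (ahead_step hj hD hpd h h').trans hB
    rcases (e.step v).of_none hn with hn' | ⟨ms, s, ds, hb, -, hs⟩
    · exact .inl ⟨h', hB', hn'⟩
    · obtain ⟨hs, ho⟩ := hs (by omega)
      exact .inr ⟨h', hB', hfill v hv h hB hs ho hb⟩

/-- Each predecessor in the queue costs one round to enter the buffer and `x` rounds to leave it,
and is then no longer ahead of `p`. The message itself costs one round to be copied, `w` to be
answered and one for `R7`. -/
theorem reaches_answer_of_card_le {x : ℕ} (hw : e.Relays (j + 1) w) (hx : e.Empties (j + 1) x)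
    (hj : 1 ≤ j) (hD : j ≤ G.diam) (hpd : p ≠ d) (b : ℕ) : ∀ {t : ℕ}, e.GoodFrom j t →
    (e.conf t).Holds p j m r l d .S → (e.conf t).buf r (j + 1) = none →
    ((e.conf t).ahead r (j + 1) p).card ≤ b →
    Reaches e.en e.sel (b * (x + 1) + w + 2) t fun u =>
      ∃ c, c ≠ .S ∧ (e.conf u).Holds p j m r l d c := by
  induction b with
  | zero =>
    intro t hg h hn hb
    rw [Nat.le_zero, Finset.card_eq_zero] at hb
    refine ((reaches_filled hT hj hD hpd hg h hn).trans e.finitelyFair (l := w + 1) ?_).mono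
      e.finitelyFair (by omega)
    rintro u hu ⟨h, -, ms, rs, s, ds, hs, ⟨rfl, rfl, rfl⟩ | hmem⟩
    · exact reaches_answer_of_received hT hw hj hD hpd (hg.of_le hj hu) h ⟨_, hs⟩
    · rw [hb] at hmem
      simp at hmem
  | succ b ih =>
    intro t hg h hn hb
    refine ((reaches_filled hT hj hD hpd hg h hn).trans e.finitelyFair
      (l := x + (b * (x + 1) + w + 2)) ?_).mono e.finitelyFair (by ring_nf; omega)
    rintro u hu ⟨h, hB, ms, rs, s, ds, hs, ⟨rfl, rfl, rfl⟩ | hmem⟩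
    · exact (reaches_answer_of_received hT hw hj hD hpd (hg.of_le hj hu) h ⟨_, hs⟩).mono
        e.finitelyFair (by omega)
    · refine (reaches_empty_ahead hx hj hD hpd (hg.of_le hj hu) h hs).trans e.finitelyFair ?_
      rintro v hv (h | ⟨h, hn, hB'⟩)
      · exact (Reaches.refl h).mono e.finitelyFair (by omega)
      · refine ih (hg.of_le hj (hu.trans hv)) h hn ?_
        have h1 := Finset.card_le_card (hB'.trans (Finset.sdiff_subset_sdiff hB subset_rfl))
        rw [Finset.card_sdiff_of_subset (by simpa using hmem), Finset.card_singleton] at h1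
        omega

theorem Relays.pred [DecidableRel G.Adj] {k : ℕ} (hj : 1 ≤ j) (hk : j + k = G.diam)
    (hw : e.Relays (j + 1) w) :
    e.Relays j ((G.maxDegree - 1) * (w + 4 * (k + 1) + 1) + w + 2) := by
  intro t p r l d m hg h
  have hD : j ≤ G.diam := by omega
  by_cases hpd : p = d
  · subst hpd
    exact ((reaches_delivered hT hj (by omega) h).mono_right fun u hu => ⟨_, by simp, hu⟩).mono
      e.finitelyFair (by omega)
  have hx := Relays.empties hT hj hk hw
  have hadj : G.Adj r p := ((e.valid t).next_adj _ _ _ h).symm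
  have hsub : (e.conf t).ahead r (j + 1) p ⊆ G.neighborFinset r \ {p} := by
    intro s hs
    rw [Finset.mem_sdiff, SimpleGraph.mem_neighborFinset, Finset.mem_singleton]
    exact ⟨((e.valid t).candidate_of_mem_ahead (by omega) (by omega) hs).1,
      Config.ne_of_mem_ahead hs⟩
  have hdeg : (G.neighborFinset r \ {p}).card ≤ G.maxDegree - 1 := by
    rw [Finset.card_sdiff_of_subset (by simpa using hadj), Finset.card_singleton]
    exact Nat.sub_le_sub_right (G.degree_le_maxDegree r) 1
  rcases hb : (e.conf t).buf r (j + 1) with _ | ⟨ms, rs, s, ds, cs⟩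
  · exact reaches_answer_of_card_le hT hw hx hj hD hpd _ hg h hb
      ((Finset.card_le_card hsub).trans hdeg)
  · obtain ⟨-, hup⟩ := hg j le_rfl hD r _ _ _ _ _ hb
    have hadj' : G.Adj r s := (e.valid t).last_adj _ _ _ hb
    by_cases hsp : s = p
    · subst hsp
      have : ms = m ∧ ds = d := by
        rcases hup with ⟨⟨q, ho⟩, -⟩ | ⟨hc, q, ho⟩
        · obtain ⟨rfl, -, -, rfl, -⟩ := h.inj ho; exact ⟨rfl, rfl⟩
        · obtain ⟨rfl, -, -, rfl, -⟩ := h.inj ho; exact ⟨rfl, rfl⟩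
      obtain ⟨rfl, rfl⟩ := this
      exact (reaches_answer_of_received hT hw hj hD hpd hg h ⟨_, hb⟩).mono
        e.finitelyFair (by omega)
    · have hmem : s ∈ G.neighborFinset r \ {p} := by
        simp [hadj', hsp]
      have hpos : 0 < (G.neighborFinset r \ {p}).card := Finset.card_pos.2 ⟨s, hmem⟩
      -- The initial occupant `s` is itself one of the Δ - 1 possible competitors and is not ahead
      -- after the emptying, so an occupied buffer is no worse than a full queue.
      obtain ⟨b, hb'⟩ : ∃ b, G.maxDegree - 1 = b + 1 := ⟨G.maxDegree - 2, by omega⟩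
      rw [hb']
      refine ((reaches_empty_ahead hx hj hD hpd hg h hb).trans e.finitelyFair
        (l := b * (w + 4 * (k + 1) + 1) + w + 2) ?_).mono e.finitelyFair (by ring_nf; omega)
      rintro u hu (h | ⟨h, hn, hB⟩)
      · exact (Reaches.refl h).mono e.finitelyFair (by omega)
      · refine reaches_answer_of_card_le hT hw hx hj hD hpd b (hg.of_le hj hu) h hn ?_
        have h1 := Finset.card_le_card (hB.trans (Finset.sdiff_subset_sdiff hsub subset_rfl))
        rw [Finset.card_sdiff_of_subset (by simpa using hmem), Finset.card_singleton] at h1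
        omega

theorem relays [DecidableRel G.Adj] (k : ℕ) : ∀ {i : ℕ}, 1 ≤ i → i + k = G.diam + 1 →
    e.Relays i (relayBound G.maxDegree k) := by
  induction k with
  | zero =>
    intro i _ hi
    obtain rfl : i = G.diam + 1 := by omega
    exact relays_top hT
  | succ k ih =>
    intro i hi hik
    exact Relays.pred hT hi (by omega) (ih (by omega) (by omega))

/-- All buffers of the ranks `2, …, D + 1` become good. -/
theorem reaches_goodFrom [DecidableRel G.Adj] (k : ℕ) : k ≤ G.diam → ∀ t,
    Reaches e.en e.sel (∑ i ∈ Finset.range k, (relayBound G.maxDegree i + 4 * (i + 1))) t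
      (e.GoodFrom (G.diam + 1 - k)) := by
  induction k with
  | zero => exact fun _ t => Reaches.refl fun i hi hD => by omega
  | succ k ih =>
    intro hk t
    rw [Finset.sum_range_succ]
    refine (ih (by omega) t).trans e.finitelyFair fun u hu hg => ?_
    obtain ⟨j, hj⟩ : ∃ j, j + k = G.diam := ⟨G.diam - k, by omega⟩
    rw [show G.diam + 1 - k = j + 1 by omega] at hg
    rw [show G.diam + 1 - (k + 1) = j by omega]
    have hx := Relays.empties hT (by omega) hj (relays hT k (i := j + 1) (by omega) (by omega))
    -- The processors empty their buffers at different times; since goodness persists, all buffers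
    -- are good at the common end of the allotted rounds.
    refine ⟨_, e.finitelyFair.le_iterate _ _, le_rfl, fun i hi hD q => ?_⟩
    rcases Nat.eq_or_lt_of_le hi with rfl | hlt
    · obtain ⟨v, huv, hv, hn⟩ := hx _ q hg
      have : ∀ w, v ≤ w → (e.conf w).Good q j := by
        intro w hw
        induction w, hw using Nat.le_induction with
        | base => exact Config.good_of_none hn
        | succ w _ ihw => exact (e.step w).good (e.valid w) (e.valid _) (by omega) hD ihw
      exact this _ hv
    · exact (hg.of_le (by omega) (e.finitelyFair.le_iterate _ _)) i hlt hD q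

end

end Execution

/-! ### No failure along correct routing tables. -/

namespace Config

/-- The copies of the message `m` of destination `d` made from `z` in the buffer of rank `i` of `y`,
and from there along the routing tables in at most `k` further buffers, are on their way to `d` and
have not failed. -/
def NoFail (γ : Config A M) (m : M) (d : Fin n) : ℕ → Fin n → ℕ → Fin n → Prop
  | 0, y, i, z => ∀ r c, γ.Holds y i m r z d c → c ≠ .F
  | k + 1, y, i, z => ∀ r c, γ.Holds y i m r z d c →
      c ≠ .F ∧ (y ≠ d → r = γ.hop y d ∧ NoFail γ m d k r (i + 1) y)

variable {γ : Config A M} {m : M} {d y z : Fin n} {i k : ℕ}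

theorem NoFail.ne_F (h : γ.NoFail m d k y i z) {c : Kind} (hr : γ.Received y i m z d c) :
    c ≠ .F := by
  obtain ⟨r, hr⟩ := hr
  cases k with
  | zero => exact h r c hr
  | succ k => exact (h r c hr).1

theorem noFail_of_not_received (h : ∀ c, ¬ γ.Received y i m z d c) : γ.NoFail m d k y i z := by
  cases k with
  | zero => exact fun r c hr => absurd ⟨r, hr⟩ (h c)
  | succ k => exact fun r c hr => absurd ⟨r, hr⟩ (h c)

end Config

namespace Step

variable {γ γ' : Config A M} {sel : Fin n → Option (Action A)} {m : M} {d y z : Fin n} {i k : ℕ}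

theorem not_received (hs : Step γ sel γ') (hi : 1 ≤ i) (h : ∀ c, ¬ γ.Received y (i + 1) m z d c)
    (ho : ¬ γ.Offers z i m y d .S) (c : Kind) : ¬ γ'.Received y (i + 1) m z d c := by
  rintro ⟨r, hr⟩
  rcases hb : γ.buf y (i + 1) with _ | ⟨m₁, r₁, l₁, d₁, c₁⟩
  · rcases hs.of_none hb with h' | ⟨m', l', d', hm, -, hq⟩
    · rw [h'] at hr; cases hr
    · obtain ⟨rfl, rfl, rfl, rfl, rfl⟩ := Config.Holds.inj hr hm
      exact ho (hq (by omega)).2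
  · by_cases hc₁ : c₁ = .S
    · subst hc₁
      rcases hs.of_S hb with h' | ⟨c', -, h', -⟩ <;>
      · obtain ⟨rfl, rfl, rfl, rfl, -⟩ := Config.Holds.inj hr h'
        exact h _ ⟨_, hb⟩
    · rcases hs.of_ne_S hb hc₁ with h' | ⟨-, ⟨h', -⟩ | h'⟩
      · obtain ⟨rfl, rfl, rfl, rfl, -⟩ := Config.Holds.inj hr h'
        exact h _ ⟨_, hb⟩
      · rw [h'] at hr; cases hr
      · omega

/-- The parameter `k` counts the ranks above `i`, and the distance to `d` never exceeds it. Failures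
originate only at rank D + 1 away from the destination, but there `k = 0` forces `y = d`. -/
theorem noFail (hs : Step γ sel γ') (hrt : γ'.rt = γ.rt) (hC : A.CorrectTables γ.rt) :
    ∀ {k y i z}, i + k = G.diam + 1 → 2 ≤ i → (G.Reachable y d ∧ G.dist y d ≤ k) →
      γ.NoFail m d k y i z → γ'.NoFail m d k y i z := by
  have hhop : ∀ y, γ'.hop y d = γ.hop y d := fun y => by unfold Config.hop; rw [hrt]
  intro k
  induction k with
  | zero =>
    intro y i z hi h2 ⟨hyr, hyd⟩ h r c hr
    have hyd : y = d := hyr.dist_eq_zero_iff.1 (by omega)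
    rcases hb : γ.buf y i with _ | ⟨m₁, r₁, l₁, d₁, c₁⟩
    · rcases hs.of_none hb with h' | ⟨m', l', d', hm, -, -⟩
      · rw [Config.Holds, h'] at hr; cases hr
      · obtain ⟨-, -, -, -, rfl⟩ := hr.inj hm
        simp
    · by_cases hc₁ : c₁ = .S
      · subst hc₁
        rcases hs.of_S hb with h' | ⟨c', -, h', h3⟩
        · obtain ⟨-, -, -, -, rfl⟩ := hr.inj h'
          simp
        · obtain ⟨rfl, rfl, rfl, rfl, rfl⟩ := hr.inj h'
          rcases h3 with h3 | h3 | h3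
          · rw [h3.2]; simp
          · exact absurd hyd h3.1
          · exact absurd hyd h3.1
      · rcases hs.of_ne_S hb hc₁ with h' | ⟨-, ⟨h', -⟩ | h'⟩
        · obtain ⟨rfl, rfl, rfl, rfl, rfl⟩ := hr.inj h'
          exact h _ _ hb
        · rw [Config.Holds, h'] at hr; cases hr
        · omega
  | succ k ih =>
    intro y i z hi h2 ⟨hyr, hyd⟩ h r c hr
    have hrec : ∀ r' c', γ.Holds y i m r' z d c' → y ≠ d → r' = γ'.hop y d ∧
        γ'.NoFail m d k r' (i + 1) y := by
      intro r' c' hb hne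
      obtain ⟨-, h3⟩ := h r' c' hb
      obtain ⟨rfl, h4⟩ := h3 hne
      refine ⟨(hhop y).symm, ih (by omega) (by omega) ⟨?_, ?_⟩ h4⟩
      · exact (A.nextHop_adj y (γ.rt y) d).symm.reachable.trans hyr
      · have : G.dist (γ.hop y d) d + 1 = G.dist y d := hC y d hne
        omega
    rcases hb : γ.buf y i with _ | ⟨m₁, r₁, l₁, d₁, c₁⟩
    · rcases hs.of_none hb with h' | ⟨m', l', d', hm, hno, -⟩
      · rw [Config.Holds, h'] at hr; cases hr
      · obtain ⟨rfl, rfl, rfl, rfl, rfl⟩ := hr.inj hm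
        -- Behind a fresh copy there is no stale one: the guard of the creating rule excludes it
        -- before the step, and none arises during the step because the buffer of `y` was empty.
        refine ⟨by simp, fun _ => ⟨(hhop y).symm, Config.noFail_of_not_received fun c => ?_⟩⟩
        refine hs.not_received (by omega) (hno (by omega)) ?_ c
        rintro ⟨q, hq⟩
        rw [hb] at hq; cases hq
    · by_cases hc₁ : c₁ = .S
      · subst hc₁
        rcases hs.of_S hb with h' | ⟨c', -, h', h3⟩
        · obtain ⟨rfl, rfl, rfl, rfl, rfl⟩ := hr.inj h'
          exact ⟨by simp, hrec _ _ hb⟩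
        · obtain ⟨rfl, rfl, rfl, rfl, rfl⟩ := hr.inj h'
          refine ⟨?_, hrec _ _ hb⟩
          rcases h3 with h3 | h3 | h3
          · rw [h3.2]; simp
          · omega
          · exact ((h _ _ hb).2 h3.1).2.ne_F h3.2.2
      · rcases hs.of_ne_S hb hc₁ with h' | ⟨-, ⟨h', -⟩ | h'⟩
        · obtain ⟨rfl, rfl, rfl, rfl, rfl⟩ := hr.inj h'
          exact ⟨(h _ _ hb).1, hrec _ _ hb⟩
        · rw [Config.Holds, h'] at hr; cases hr
        · omega

end Step

/-! ### Emptying the buffers of rank 1. -/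

namespace Execution

variable {e : Execution A M} (hT : e.Silent) {t : ℕ} {p r l d : Fin n} {m : M} {c : Kind}
include hT

theorem reaches_free (hD : 1 ≤ G.diam) (hg : e.GoodFrom 1 t) (hc : c ≠ .S) (hpd : p ≠ d)
    (h : (e.conf t).Holds p 1 m r l d c) :
    Reaches e.en e.sel (4 * G.diam) t fun u =>
      (e.conf u).Holds p 1 m r l d c ∧ (e.conf u).Free p 1 m r d c := by
  by_cases hf : (e.conf t).Free p 1 m r d c
  · exact (Reaches.refl ⟨h, hf⟩).mono e.finitelyFair (by omega)
  · have hr := hf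
    unfold Config.Free at hr
    push Not at hr
    obtain ⟨-, q, hq⟩ := hr
    have h1 := reaches_none_of_ne_S hT (G.diam - 1) (j := 1) (by omega) le_rfl hc
      (fun i hi => hg i (by omega)) hq
    refine ((h1.stays_or (I := fun v => (e.conf v).Holds p 1 m r l d c ∧
      ¬ (e.conf v).Free p 1 m r d c) (J := fun v => (e.conf v).Holds p 1 m r l d c ∧
      (e.conf v).Free p 1 m r d c) ⟨h, hf⟩ ?_).mono_right ?_).mono e.finitelyFair (by omega)
    · rintro v - ⟨h, hf⟩
      rcases (e.step v).of_ne_S h hc with h' | ⟨h' | h' | h', -⟩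
      · by_cases hf' : (e.conf (v + 1)).Free p 1 m r d c
        · exact .inr ⟨h', hf'⟩
        · exact .inl ⟨h', hf'⟩
      · exact absurd h' hpd
      · omega
      · exact absurd (fun _ => h') hf
    · rintro u (⟨hn, h, hf⟩ | h)
      · refine absurd ?_ hf
        rintro - ⟨q, hq⟩
        rw [hn] at hq; cases hq
      · exact h

theorem reaches_none_of_A (hD : 1 ≤ G.diam) (hg : e.GoodFrom 1 t) (hpd : p ≠ d)
    (h : (e.conf t).Holds p 1 m r l d .A) :
    Reaches e.en e.sel (4 * G.diam + 1) t fun u => (e.conf u).buf p 1 = none := by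
  refine (reaches_free hT hD hg (by simp) hpd h).trans e.finitelyFair ?_
  rintro u hu ⟨h, hf⟩
  refine ensures_rule hT p .R3 1 (I := fun v => (e.conf v).Holds p 1 m r l d .A ∧
    (e.conf v).Free p 1 m r d .A) ⟨h, hf⟩ ?_ ?_ ?_
  · rintro v - ⟨h, hf⟩
    exact ⟨_, .r3 m r l d h (Ne.symm hpd) fun q hq => hf hD ⟨q, hq⟩⟩
  · rintro v - ⟨h, hf⟩ hfire
    obtain ⟨-, ⟨hn, -⟩ | ⟨-, h', -⟩⟩ := hfire.of_ne_S h (by simp)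
    · exact hn
    · cases h'
  · rintro v hv ⟨h, hf⟩
    rcases (e.step v).of_ne_S h (by simp) with h' | ⟨-, ⟨hn, -⟩ | ⟨-, h', -⟩⟩
    · exact .inl ⟨h', (e.step v).free le_rfl
        (fun _ => (hg.of_le le_rfl (hu.trans hv)) 1 le_rfl hD r) h (by simp) hf⟩
    · exact .inr hn
    · cases h'

/-- When `R2` fires, goodness and the absence of a failed copy at `r` leave no copy of the message
from `p` in any buffer of rank 2. The new sending thus starts with `NoFail` vacuously true. -/
theorem reaches_resent (hD : 1 ≤ G.diam) (hg : e.GoodFrom 1 t) (hpd : p ≠ d)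
    (h : (e.conf t).Holds p 1 m r l d .F) :
    Reaches e.en e.sel (4 * G.diam + 1) t fun u => ∃ y, y = (e.conf u).hop p d ∧
      (e.conf u).Holds p 1 m y l d .S ∧ (e.conf u).NoFail m d (G.diam - 1) y 2 p := by
  have hhop : ∀ v, (e.conf (v + 1)).hop p d = (e.conf v).hop p d := fun v => by
    unfold Config.hop; rw [e.rt_succ_of_terminal (hT v)]
  have hnew : ∀ v, t ≤ v → (e.conf v).Holds p 1 m r l d .F → (e.conf v).Free p 1 m r d .F →
      (e.conf (v + 1)).NoFail m d (G.diam - 1) ((e.conf v).hop p d) 2 p := by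
    intro v hv h hf
    refine Config.noFail_of_not_received fun c => (e.step v).not_received le_rfl ?_ ?_ c
    · rintro c ⟨q, hq⟩
      obtain ⟨-, ⟨⟨x, hx⟩, -⟩ | ⟨-, x, hx⟩⟩ := (hg.of_le le_rfl hv) 1 le_rfl hD _ _ _ _ _ _ hq
      · obtain ⟨-, -, -, -, h'⟩ := h.inj hx
        cases h'
      · obtain ⟨-, rfl, -, -, rfl⟩ := h.inj hx
        exact hf hD ⟨q, hq⟩
    · rintro ⟨x, hx⟩
      obtain ⟨-, -, -, -, h'⟩ := h.inj hx
      cases h'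
  refine (reaches_free hT hD hg (by simp) hpd h).trans e.finitelyFair ?_
  rintro u hu ⟨h, hf⟩
  refine ensures_rule hT p .R2 1 (I := fun v => (e.conf v).Holds p 1 m r l d .F ∧
    (e.conf v).Free p 1 m r d .F) ⟨h, hf⟩ ?_ ?_ ?_
  · rintro v - ⟨h, hf⟩
    exact ⟨_, .r2 m r l d h (Ne.symm hpd) fun q hq => hf hD ⟨q, hq⟩⟩
  · rintro v hv ⟨h, hf⟩ hfire
    have hs := hfire
    generalize hb : (e.conf (v + 1)).buf p 1 = b at hs
    cases hs with
    | r2 m' r' q' d' h' =>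
      obtain ⟨rfl, rfl, rfl, rfl, -⟩ := h.inj h'
      exact ⟨_, rfl, by rw [hhop]; exact hb, by rw [hhop]; exact hnew v (hu.trans hv) h hf⟩
  · rintro v hv ⟨h, hf⟩
    rcases (e.step v).of_ne_S h (by simp) with h' | ⟨-, ⟨-, -, hA⟩ | ⟨-, -, y, hy, h' | h'⟩⟩
    · exact .inl ⟨h', (e.step v).free le_rfl
        (fun _ => (hg.of_le le_rfl (hu.trans hv)) 1 le_rfl hD r) h (by simp) hf⟩
    · cases hA hD rfl
    · exact absurd h'.1 hpd
    · obtain ⟨-, rfl⟩ := h'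
      exact .inr ⟨_, (hhop v).symm, hy, hnew v (hu.trans hv) h hf⟩

end Execution

namespace Execution

section

variable {e : Execution A M} (hT : e.Silent) {t : ℕ} {p r l d : Fin n} {m : M} {c : Kind}
include hT

theorem reaches_none_of_A_self (h : (e.conf t).Holds p 1 m r l p .A) :
    Reaches e.en e.sel 1 t fun u => (e.conf u).buf p 1 = none := by
  refine ensures_rule hT p .R5 1 (I := fun v => (e.conf v).Holds p 1 m r l p .A) h
    (fun v _ h => ⟨_, .r5 m r l h⟩) ?_ ?_
  · rintro v - h hfire
    obtain ⟨-, ⟨hn, -⟩ | ⟨-, h', -⟩⟩ := hfire.of_ne_S h (by simp)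
    · exact hn
    · cases h'
  · rintro v - h
    rcases (e.step v).of_ne_S h (by simp) with h' | ⟨-, ⟨hn, -⟩ | ⟨-, h', -⟩⟩
    · exact .inl h'
    · exact .inr hn
    · cases h'

theorem reaches_none_of_S_self (h : (e.conf t).Holds p 1 m r l p .S) :
    Reaches e.en e.sel 2 t fun u => (e.conf u).buf p 1 = none :=
  (reaches_delivered hT le_rfl (by omega) h).trans e.finitelyFair
    fun _ _ h => reaches_none_of_A_self hT h

theorem reaches_none_of_F_self (hD : 1 ≤ G.diam) (h : (e.conf t).Holds p 1 m r l p .F) :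
    Reaches e.en e.sel 3 t fun u => (e.conf u).buf p 1 = none := by
  have h1 : Reaches e.en e.sel 1 t fun u => ∃ y, (e.conf u).Holds p 1 m y l p .S := by
    refine ensures_rule hT p .R6 1 (I := fun v => (e.conf v).Holds p 1 m r l p .F) h
      (fun v _ h => ⟨_, .r6 m r l h⟩) ?_ ?_
    · rintro v - h hfire
      obtain ⟨-, ⟨-, -, hA⟩ | ⟨-, -, y, hy, -⟩⟩ := hfire.of_ne_S h (by simp)
      · cases hA hD rfl
      · exact ⟨y, hy⟩
    · rintro v - h
      rcases (e.step v).of_ne_S h (by simp) with h' | ⟨-, ⟨-, -, hA⟩ | ⟨-, -, y, hy, -⟩⟩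
      · exact .inl h'
      · cases hA hD rfl
      · exact .inr ⟨y, hy⟩
  exact h1.trans e.finitelyFair fun _ _ ⟨_, h⟩ => reaches_none_of_S_self hT h

variable [DecidableRel G.Adj]

/-- A message that is sent along correct routing tables is acknowledged. -/
theorem reaches_acknowledged (hG : G.Connected) (hD : 1 ≤ G.diam)
    (hdist : ∀ x y, G.dist x y ≤ G.diam) (hC : ∀ v, A.CorrectTables (e.conf v).rt)
    (hg : e.GoodFrom 1 t) (hpd : p ≠ d) (hr : r = (e.conf t).hop p d)
    (h : (e.conf t).Holds p 1 m r l d .S) (hf : (e.conf t).NoFail m d (G.diam - 1) r 2 p) :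
    Reaches e.en e.sel (relayBound G.maxDegree G.diam) t fun u =>
      (e.conf u).Holds p 1 m r l d .A := by
  have hrd : G.dist r d ≤ G.diam - 1 := by
    have h1 : G.dist ((e.conf t).hop p d) d + 1 = G.dist p d := hC t p d hpd
    rw [← hr] at h1
    have := hdist p d
    omega
  refine (((relays hT G.diam le_rfl (by omega)) _ _ _ _ _ _ hg h).stays_or
    (I := fun v => (e.conf v).Holds p 1 m r l d .S ∧ (e.conf v).NoFail m d (G.diam - 1) r 2 p)
    (J := fun v => (e.conf v).Holds p 1 m r l d .A) ⟨h, hf⟩ ?_).mono_right ?_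
  · rintro v - ⟨h, hf⟩
    have hf' := (e.step v).noFail (e.rt_succ_of_terminal (hT v)) (hC v) (by omega) le_rfl
      ⟨hG.preconnected _ _, hrd⟩ hf
    rcases (e.step v).of_S h with h' | ⟨c, hc, h', h3 | h3 | h3⟩
    · exact .inl ⟨h', hf'⟩
    · exact absurd h3.1 hpd
    · omega
    · obtain rfl : c = .A := (Kind.ne_S.1 hc).resolve_left (hf.ne_F h3.2.2)
      exact .inr h'
  · rintro u (⟨⟨c, hc, h⟩, h', -⟩ | h)
    · exact absurd (h'.inj h).2.2.2.2 hc
    · exact h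

/-- The factor 2 accounts for one retry: the message present initially may fail because of old
routes or stale copies, but after `reaches_resent` the answer is an acknowledgment. -/
theorem reaches_none (hG : G.Connected) (hD : 1 ≤ G.diam)
    (hdist : ∀ x y, G.dist x y ≤ G.diam) (hC : ∀ v, A.CorrectTables (e.conf v).rt)
    (hg : e.GoodFrom 1 t) (p : Fin n) :
    Reaches e.en e.sel (2 * (relayBound G.maxDegree G.diam + (4 * G.diam + 1))) t
      fun u => (e.conf u).buf p 1 = none := by
  have hfin := e.finitelyFair
  have hw := one_le_relayBound G.maxDegree G.diam
  rcases hb : (e.conf t).buf p 1 with _ | ⟨m, r, l, d, c⟩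
  · exact (Reaches.refl hb).mono hfin (by omega)
  by_cases hpd : p = d
  · subst hpd
    cases c with
    | S => exact (reaches_none_of_S_self hT hb).mono hfin (by omega)
    | A => exact (reaches_none_of_A_self hT hb).mono hfin (by omega)
    | F => exact (reaches_none_of_F_self hT hD hb).mono hfin (by omega)
  have hF : ∀ u, t ≤ u → (e.conf u).Holds p 1 m r l d .F →
      Reaches e.en e.sel (4 * G.diam + 1 + (relayBound G.maxDegree G.diam + (4 * G.diam + 1))) u
        fun u => (e.conf u).buf p 1 = none := by
    intro u hu h
    refine (reaches_resent hT hD (hg.of_le le_rfl hu) hpd h).trans hfin ?_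
    rintro v hv ⟨y, hy, h, hf⟩
    have hg' := hg.of_le le_rfl (hu.trans hv)
    refine (reaches_acknowledged hT hG hD hdist hC hg' hpd hy h hf).trans hfin ?_
    exact fun w hw h => reaches_none_of_A hT hD (hg'.of_le le_rfl hw) hpd h
  have hAF : ∀ u c, t ≤ u → c ≠ .S → (e.conf u).Holds p 1 m r l d c →
      Reaches e.en e.sel (4 * G.diam + 1 + (relayBound G.maxDegree G.diam + (4 * G.diam + 1))) u
        fun u => (e.conf u).buf p 1 = none := by
    intro u c hu hc h
    rcases Kind.ne_S.1 hc with rfl | rfl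
    · exact hF u hu h
    · exact (reaches_none_of_A hT hD (hg.of_le le_rfl hu) hpd h).mono hfin (by omega)
  by_cases hc : c = .S
  · subst hc
    refine (((relays hT G.diam le_rfl (by omega)) _ _ _ _ _ _ hg hb).trans hfin
      fun u hu ⟨c, hc, h⟩ => hAF u c hu hc h).mono hfin (by omega)
  · exact (hAF t c le_rfl hc hb).mono hfin (by omega)

end

/-! ### From empty buffers to emissions. -/

variable {e : Execution A M} {t : ℕ} {p : Fin n}

theorem pending_step (h : e.Pending p t) : e.Pending p (t + 1) ∨ e.Emits p t := by
  by_cases hem : e.Emits p t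
  · exact .inr hem
  · obtain ⟨h1, h2, -⟩ := (e.step t).higher_idle p hem
    exact .inl ⟨h2 h.1, by rw [h1 h.2]; exact h.2⟩

variable (e p) in
/-- Processor `p` emits a message between the configurations `s` and `t`. -/
def EmitsBetween (s t : ℕ) : Prop := ∃ v, s ≤ v ∧ v < t ∧ e.Emits p v

theorem pending_or_emitsBetween {s : ℕ} (hst : s ≤ t) (h : e.Pending p t) :
    e.Pending p (t + 1) ∨ e.EmitsBetween p s (t + 1) :=
  pending_step h |>.imp_right fun h => ⟨t, hst, Nat.lt_add_one t, h⟩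

theorem buf_one_step (hD : 1 ≤ G.diam) (hem : ¬ e.Emits p t) (hn : (e.conf t).buf p 1 = none) :
    (e.conf (t + 1)).buf p 1 = none := by
  by_cases h : ∃ k, e.sel t p = some (.inr (k, 1))
  · obtain ⟨k, hk⟩ := h
    obtain ⟨b, hf, -⟩ := (e.step t).buf_move p k 1 hk
    exfalso
    generalize hi : (1 : ℕ) = i at hf
    cases hf with
    | r1 => exact hem hk
    | _ => first | omega | simp_all
  · push Not at h
    by_cases h' : ∃ k i, e.sel t p = some (.inr (k, i))
    · obtain ⟨k, i, hk⟩ := h'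
      obtain ⟨b, -, hb⟩ := (e.step t).buf_move p k i hk
      have : (1 : ℕ) ≠ i := by rintro rfl; exact h k hk
      rw [hb, Function.update_of_ne this, hn]
    · push Not at h'
      rw [(e.step t).buf_idle p h', hn]

/-- By goodness an empty buffer of rank 1 has no copy behind it, so the last condition of `R1`
holds; nothing but `R1` fills this buffer, and the request is not withdrawn. -/
theorem reaches_emission (hT : e.Silent) (hD : 1 ≤ G.diam) (hg : e.GoodFrom 1 t)
    (hn : (e.conf t).buf p 1 = none) (h : e.Pending p t) :
    Reaches e.en e.sel 1 t (e.EmitsBetween p t) := by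
  refine Reaches.ensures e.finitelyFair p sendAction
    (I := fun v => e.Pending p v ∧ (e.conf v).buf p 1 = none) ⟨h, hn⟩ ?_ ?_ ?_
  · rintro v hv ⟨⟨hreq, hw⟩, hn⟩
    obtain ⟨⟨m, d⟩, hmd⟩ := Option.ne_none_iff_exists'.1 hw
    refine ⟨⟨_, .r1 m ((e.conf v).hop p d) d hreq hn hmd ?_ (A.nextHop_adj _ _ _)⟩, hT v p⟩
    intro r' c hr
    obtain ⟨-, ⟨⟨x, hx⟩, -⟩ | ⟨-, x, hx⟩⟩ := (hg.of_le le_rfl hv) 1 le_rfl hD _ _ _ _ _ _ hr <;>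
    · rw [hn] at hx; cases hx
  · rintro v hv - hem
    exact ⟨v, hv, Nat.lt_add_one v, hem⟩
  · rintro v hv ⟨h, hn⟩
    by_cases hem : e.Emits p v
    · exact .inr ⟨v, hv, Nat.lt_add_one v, hem⟩
    · rcases pending_step h with h | h
      · exact .inl ⟨h, buf_one_step hD hem hn⟩
      · exact absurd h hem

variable [DecidableRel G.Adj]

/-- Bound on the number of rounds before an emission when the routing tables are correct. -/
noncomputable def emissionBound (G : SimpleGraph (Fin n)) [DecidableRel G.Adj] : ℕ :=
  (∑ i ∈ Finset.range G.diam, (relayBound G.maxDegree i + 4 * (i + 1))) +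
    (2 * (relayBound G.maxDegree G.diam + (4 * G.diam + 1)) + 1)

theorem reaches_emission_of_silent (hT : e.Silent) (hG : G.Connected) (hD : 1 ≤ G.diam)
    (hdist : ∀ x y, G.dist x y ≤ G.diam) (hC : ∀ v, A.CorrectTables (e.conf v).rt)
    (h : e.Pending p t) : Reaches e.en e.sel (emissionBound G) t (e.EmitsBetween p t) := by
  have hfin := e.finitelyFair
  refine ((reaches_goodFrom hT G.diam le_rfl t).stays_or h fun v hv h =>
    pending_or_emitsBetween hv h).trans hfin ?_
  rintro u hu (⟨hg, h⟩ | h)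
  · rw [Nat.add_sub_cancel_left] at hg
    refine ((reaches_none hT hG hD hdist hC hg p).stays_or h fun v hv h =>
      pending_or_emitsBetween (hu.trans hv) h).trans hfin ?_
    rintro v hv (⟨hn, h⟩ | h)
    · refine (reaches_emission hT hD (hg.of_le le_rfl hv) hn h).mono_right ?_
      rintro w ⟨x, hx, hxw⟩
      exact ⟨x, hu.trans (hv.trans hx), hxw⟩
    · exact (Reaches.refl h).mono hfin (by omega)
  · exact (Reaches.refl h).mono hfin (by omega)

omit [DecidableRel G.Adj] in
theorem emitsWithin_of_reaches {k : ℕ} (h : Reaches e.en e.sel k t (e.EmitsBetween p t)) :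
    e.EmitsWithin p t k := by
  classical
  obtain ⟨w, -, hw, hex⟩ := h
  have hex' : ∃ v, t ≤ v ∧ v < w ∧ e.Emits p v := hex
  obtain ⟨h1, h2, h3⟩ := Nat.find_spec hex'
  refine ⟨Nat.find hex', h1, h3, fun v hv hlt hem => ?_,
    e.finitelyFair.withinRounds (le_trans (by omega) hw)⟩
  exact Nat.find_min hex' hlt ⟨hv, by omega, hem⟩

/-- Either `p` emits before the tables stabilize, or the request survives and the bound for correct
tables applies to the remaining execution. -/
theorem emitsWithin (hG : G.Connected) (hD : 1 ≤ G.diam) (hdist : ∀ x y, G.dist x y ≤ G.diam)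
    {R k : ℕ} (hR : A.StabilizesWithin R) (hk : R + emissionBound G ≤ k) (h : e.Pending p t) :
    e.EmitsWithin p t k := by
  have hfin := e.finitelyFair
  refine emitsWithin_of_reaches (Reaches.mono ?_ hfin hk)
  refine ((e.exists_stabilized hR t).stays_or (I := e.Pending p) (J := e.EmitsBetween p t) h
    fun v hv h => pending_or_emitsBetween hv h).trans hfin ?_
  rintro u hu (⟨⟨hT, hC⟩, h⟩ | h)
  · have hrt : ∀ v, ((e.drop u).conf v).rt = (e.conf u).rt := fun v =>
      e.rt_of_terminal hT (Nat.le_add_right u v)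
    have hT' : (e.drop u).Silent := fun v => by rw [hrt]; exact hT
    have hC' : ∀ v, A.CorrectTables ((e.drop u).conf v).rt := fun v => by rw [hrt]; exact hC
    obtain ⟨w, -, hw, x, -, hxw, hx⟩ :=
      reaches_emission_of_silent (t := 0) hT' hG hD hdist hC' (p := p) h
    refine ⟨u + w, by omega, ?_, u + x, by omega, by omega, hx⟩
    have := (e.drop u).finitelyFair.iterate_add (en := e.en) (ex := e.sel) (s := u)
      (emissionBound G) 0
    rw [Nat.add_zero] at this
    rw [this]
    exact Nat.add_le_add_left hw u
  · exact (Reaches.refl h).mono hfin (by omega)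

end Execution

end Forwarding

/-! ## Bounds -/

theorem relayBound_le {Δ D : ℕ} (hΔ : 1 ≤ Δ) (k : ℕ) (hk : k ≤ D) :
    relayBound Δ k ≤ Δ ^ k * (1 + k * (4 * D + 3)) := by
  induction k with
  | zero => simp [relayBound]
  | succ k ih =>
    have ih := ih (by omega)
    obtain ⟨δ, rfl⟩ := Nat.exists_eq_add_of_le' hΔ
    have hpow : 1 ≤ (δ + 1) ^ k := Nat.one_le_pow _ _ (by omega)
    calc relayBound (δ + 1) (k + 1)
        = (δ + 1) * relayBound (δ + 1) k + (δ * (4 * (k + 1) + 1) + 2) := by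
          simp only [relayBound, Nat.add_sub_cancel]; ring
      _ ≤ (δ + 1) * ((δ + 1) ^ k * (1 + k * (4 * D + 3))) + (δ + 1) * (4 * D + 3) := by
          gcongr
          nlinarith
      _ ≤ (δ + 1) * ((δ + 1) ^ k * (1 + k * (4 * D + 3))) +
            (δ + 1) * ((δ + 1) ^ k * (4 * D + 3)) := by
          gcongr
          exact Nat.le_mul_of_pos_left _ hpow
      _ = (δ + 1) ^ (k + 1) * (1 + (k + 1) * (4 * D + 3)) := by ring

/-- For Δ = 1 the sum equals D, so the case D ≥ 2 has to be excluded; `two_le_maxDegree_or` does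
this for connected graphs. -/
theorem sum_pow_le {Δ D : ℕ} (h : 2 ≤ Δ ∨ D ≤ 1) (hΔ : 1 ≤ Δ) :
    ∑ i ∈ Finset.range D, Δ ^ i ≤ Δ ^ D := by
  rcases h with h | h
  · exact (Nat.geomSum_lt h (by simp)).le
  · interval_cases D <;> simp [hΔ]

theorem emissionBound_le {n : ℕ} (G : SimpleGraph (Fin n)) [DecidableRel G.Adj]
    (hD : 1 ≤ G.diam) (hn : G.diam + 1 ≤ n) (hΔ : 1 ≤ G.maxDegree)
    (h : 2 ≤ G.maxDegree ∨ G.diam ≤ 1) :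
    Execution.emissionBound G ≤ 50 * (n * G.diam * G.maxDegree ^ G.diam) := by
  unfold Execution.emissionBound
  set D := G.diam
  set Δ := G.maxDegree
  have hw : ∀ k ≤ D, relayBound Δ k + 4 * (k + 1) ≤ Δ ^ k * (9 * (n * D)) := by
    intro k hk
    -- Here D + 1 ≤ n turns the quadratic term in D into a multiple of nD. Together with 1 ≤ nD and
    -- 4(k + 1) ≤ 4nD this gives the factor 9.
    have h1 : k * (4 * D + 3) ≤ D * (4 * n) := Nat.mul_le_mul hk (by omega)
    have h2 : n ≤ n * D := Nat.le_mul_of_pos_right n hD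
    calc relayBound Δ k + 4 * (k + 1)
        ≤ Δ ^ k * (1 + k * (4 * D + 3)) + Δ ^ k * (4 * (k + 1)) :=
          Nat.add_le_add (relayBound_le hΔ k hk)
            (Nat.le_mul_of_pos_left _ (Nat.pow_pos hΔ))
      _ = Δ ^ k * (1 + k * (4 * D + 3) + 4 * (k + 1)) := by ring
      _ ≤ Δ ^ k * (9 * (n * D)) := by
          refine Nat.mul_le_mul_left _ ?_
          have : D * (4 * n) = 4 * (n * D) := by ring
          omega
  have hsum : ∑ i ∈ Finset.range D, (relayBound Δ i + 4 * (i + 1)) ≤ Δ ^ D * (9 * (n * D)) := by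
    calc _ ≤ ∑ i ∈ Finset.range D, Δ ^ i * (9 * (n * D)) :=
          Finset.sum_le_sum fun i hi => hw i (Finset.mem_range.1 hi).le
      _ = (∑ i ∈ Finset.range D, Δ ^ i) * (9 * (n * D)) := (Finset.sum_mul _ _ _).symm
      _ ≤ _ := Nat.mul_le_mul_right _ (sum_pow_le h hΔ)
  have h1 := hw D le_rfl
  have h2 : 1 ≤ n * D * Δ ^ D := Nat.mul_pos (Nat.mul_pos (by omega) hD) (Nat.pow_pos hΔ)
  have h3 : Δ ^ D * (9 * (n * D)) = 9 * (n * D * Δ ^ D) := by ring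
  omega

/-! ### Diameter and maximal degree of connected graphs. -/

section Graph

variable {n : ℕ} {G : SimpleGraph (Fin n)}

theorem exists_path_length_eq_diam (hn : 0 < n) (hG : G.Connected) :
    ∃ (u v : Fin n) (w : G.Walk u v), w.IsPath ∧ w.length = G.diam := by
  have : Nonempty (Fin n) := ⟨⟨0, hn⟩⟩
  obtain ⟨u, v, huv⟩ := G.exists_dist_eq_diam
  obtain ⟨w, hw, hl⟩ := hG.exists_path_of_dist u v
  exact ⟨u, v, w, hw, hl.trans huv⟩

theorem diam_lt (hn : 0 < n) (hG : G.Connected) : G.diam < n := by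
  obtain ⟨u, v, w, hw, hl⟩ := exists_path_length_eq_diam hn hG
  simpa [hl] using hw.length_lt

theorem one_le_diam (hn : 2 ≤ n) (hG : G.Connected) : 1 ≤ G.diam := by
  have : Nontrivial (Fin n) := Fin.nontrivial_iff_two_le.2 hn
  exact Nat.one_le_iff_ne_zero.2 (SimpleGraph.connected_iff_diam_ne_zero.1 hG)

theorem dist_le_diam (hn : 2 ≤ n) (hG : G.Connected) (x y : Fin n) : G.dist x y ≤ G.diam :=
  SimpleGraph.dist_le_diam (SimpleGraph.ediam_ne_top_of_diam_ne_zero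
    (Nat.one_le_iff_ne_zero.1 (one_le_diam hn hG)))

variable [DecidableRel G.Adj]

theorem one_le_maxDegree (hn : 2 ≤ n) (hG : G.Connected) : 1 ≤ G.maxDegree := by
  obtain ⟨u, v, w, -, hl⟩ := exists_path_length_eq_diam (by omega) hG
  have h1 := one_le_diam hn hG
  have hadj := w.adj_getVert_succ (i := 0) (by omega)
  exact ((G.degree_pos_iff_exists_adj _).2 ⟨_, hadj⟩).trans_le (G.degree_le_maxDegree _)

/-- On a path realizing a diameter of at least 2, the second vertex has two distinct neighbours. -/
theorem two_le_maxDegree_or (hn : 0 < n) (hG : G.Connected) : 2 ≤ G.maxDegree ∨ G.diam ≤ 1 := by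
  by_contra hcon
  push Not at hcon
  obtain ⟨u, v, w, hw, hl⟩ := exists_path_length_eq_diam hn hG
  have h1 := w.adj_getVert_succ (i := 0) (by omega)
  have h2 := w.adj_getVert_succ (i := 1) (by omega)
  have hne : w.getVert 0 ≠ w.getVert 2 := fun h => by
    have := hw.getVert_injOn (by simp : 0 ≤ w.length) (by omega : 2 ≤ w.length) h
    omega
  have hsub : {w.getVert 0, w.getVert 2} ⊆ G.neighborFinset (w.getVert 1) := by
    intro x hx
    rw [SimpleGraph.mem_neighborFinset]
    rcases Finset.mem_insert.1 hx with rfl | hx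
    · exact h1.symm
    · rw [Finset.mem_singleton.1 hx]; exact h2
  have h3 := Finset.card_le_card hsub
  rw [Finset.card_pair hne, SimpleGraph.card_neighborFinset_eq_degree] at h3
  have h4 := G.degree_le_maxDegree (w.getVert 1)
  omega

end Graph

end SSMFP

theorem mainTheorem8 :
    ∃ C : ℕ, ∀ (n : ℕ) (G : SimpleGraph (Fin n)) [DecidableRel G.Adj],
      2 ≤ n → G.Connected →
      ∀ (A : SSMFP.RoutingAlgorithm G) (R : ℕ), A.IsStabilizationTime R →
      ∀ (M : Type) (e : SSMFP.Execution A M) (p : Fin n),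
        e.DelayAtMost p (C * max R (n * G.diam * G.maxDegree ^ G.diam)) ∧
        e.WaitingTimeAtMost p (C * max R (n * G.diam * G.maxDegree ^ G.diam)) := by
  -- One unit pays for the stabilization time `R`, and 50 for `emissionBound`.
  refine ⟨51, fun n G _ hn hG A R hR M e p => ?_⟩
  have hD := SSMFP.one_le_diam hn hG
  have hb := SSMFP.emissionBound_le G hD (SSMFP.diam_lt (by omega) hG)
    (SSMFP.one_le_maxDegree hn hG) (SSMFP.two_le_maxDegree_or (by omega) hG)
  have key : ∀ t, e.Pending p t →
      e.EmitsWithin p t (51 * max R (n * G.diam * G.maxDegree ^ G.diam)) := by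
    intro t h
    refine SSMFP.Execution.emitsWithin hG hD (SSMFP.dist_le_diam hn hG) hR.1 ?_ h
    have := le_max_left R (n * G.diam * G.maxDegree ^ G.diam)
    have := le_max_right R (n * G.diam * G.maxDegree ^ G.diam)
    omega
  exact ⟨fun t h _ => key t h, fun _ t _ _ _ h => key t h⟩
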